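/- Let $M$ be a smooth manifold (Hausdorff, second countable, without boundary) of finite dimension $d$. A smooth function $F:M\to\mathbb R$ is called a *Bott function* if its critical points form smooth submanifolds of $M$ (possibly of different dimensions, including isolated points) and at each critical point the Hessian of $F$ is nondegenerate on the planes normal (complementary) to the critical submanifold. A *critical circle* of $F$ is a connected component $\gamma$ of the set $\mathrm{Crit}(F)$ of critical points which is a smoothly embedded circle; it has index $n$ if at each point of $\gamma$ the Hessian of $F$ (equivalently, its restriction to a plane normal to $\gamma$) has index $n$, that is, $n$ is the largest dimension of a subspace on which it is negative definite. **Proposition.** Let $F:M\to\mathbb R$ be a Bott function and let $\gamma$ be a critical circle of $F$ of index $n$. Then $\gamma$ has a neighborhood containing no critical points of $F$ outside $\gamma$. Moreover, for every neighborhood $U$ of $\gamma$ with $U\cap\mathrm{Crit}(F)=\gamma$ there is a Bott function $G:M\to\mathbb R$ such that $G=F$ outside $U$ and $U\cap\mathrm{Crit}(G)=\{w,z\}$ for two points $w,z\in\gamma$, which are nondegenerate critical points of $G$ of indices $n$ and $n+1$ respectively. -/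

import Mathlib

open scoped Manifold ContDiff Topology

namespace Bott

noncomputable section

/-- The critical points of a function `F` on a `d`-dimensional manifold. -/
def critSet (d : ℕ) {M : Type*} [TopologicalSpace M] [ChartedSpace (EuclideanSpace ℝ (Fin d)) M]
    (F : M → ℝ) : Set M :=
  {x | mfderiv (𝓡 d) 𝓘(ℝ, ℝ) F x = 0}

/-- The Hessian of `F` at `p`, read in a chart `e` around `p`: the second derivative of
`F ∘ e⁻¹` at `e p`. At a critical point `p` its rank, nullity and index, and its kernel as a
subspace of the tangent space, do not depend on the chart. -/
def hessianIn {d : ℕ} {M : Type*} [TopologicalSpace M]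
    (e : OpenPartialHomeomorph M (EuclideanSpace ℝ (Fin d))) (F : M → ℝ) (p : M) :
    LinearMap.BilinForm ℝ (EuclideanSpace ℝ (Fin d)) :=
  (fderiv ℝ (fderiv ℝ (F ∘ e.symm)) (e p)).toBilinForm

/-- The Hessian of `F` at `p`, in the preferred chart at `p`, that is, as a bilinear form on the
tangent space at `p` (which Mathlib identifies with the model space through this chart). -/
def hessian (d : ℕ) {M : Type*} [TopologicalSpace M] [ChartedSpace (EuclideanSpace ℝ (Fin d)) M]
    (F : M → ℝ) (p : M) : LinearMap.BilinForm ℝ (EuclideanSpace ℝ (Fin d)) :=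
  hessianIn (chartAt (EuclideanSpace ℝ (Fin d)) p) F p

/-- The index of `F` at `p`: the largest dimension of a subspace on which the Hessian is negative
definite. -/
def index (d : ℕ) {M : Type*} [TopologicalSpace M] [ChartedSpace (EuclideanSpace ℝ (Fin d)) M]
    (F : M → ℝ) (p : M) : ℕ :=
  sigNeg (LinearMap.BilinMap.toQuadraticMap (hessian d F p))

/-- `p` is a nondegenerate critical point of `F` of index `k`. -/
def IsNondegenerateCriticalPoint (d : ℕ) {M : Type*} [TopologicalSpace M]
    [ChartedSpace (EuclideanSpace ℝ (Fin d)) M] (F : M → ℝ) (p : M) (k : ℕ) : Prop :=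
  p ∈ critSet d F ∧ (hessian d F p).Nondegenerate ∧ index d F p = k

/-- A Bott function: a smooth function whose critical points form nondegenerate critical smooth
submanifolds. Around each critical point `p` there is a smooth chart `e` in which the critical set
is a linear subspace `S` (translated to `e p`), so that `S` is the tangent space at `p` of the
critical submanifold, and the Hessian at `p` is nondegenerate on every plane `N` normal
(complementary) to `S`. The dimension of `S` may vary from one critical submanifold to another, and
may be `0`. -/
def IsBott (d : ℕ) {M : Type*} [TopologicalSpace M] [ChartedSpace (EuclideanSpace ℝ (Fin d)) M]
    (F : M → ℝ) : Prop :=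
  ContMDiff (𝓡 d) 𝓘(ℝ, ℝ) ∞ F ∧
    ∀ p ∈ critSet d F, ∃ e ∈ IsManifold.maximalAtlas (𝓡 d) ∞ M, p ∈ e.source ∧
      ∃ S : Submodule ℝ (EuclideanSpace ℝ (Fin d)),
        (∀ x ∈ e.source, x ∈ critSet d F ↔ e x - e p ∈ S) ∧
        ∀ N : Submodule ℝ (EuclideanSpace ℝ (Fin d)), IsCompl S N →
          ((hessianIn e F p).restrict N).Nondegenerate

/-- `γ` is a critical circle of `F`: a connected component of the critical set which is a smoothly
embedded circle. -/
def IsCriticalCircle (d : ℕ) {M : Type*} [TopologicalSpace M]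
    [ChartedSpace (EuclideanSpace ℝ (Fin d)) M] (F : M → ℝ) (γ : Set M) : Prop :=
  (∃ p ∈ critSet d F, γ = connectedComponentIn (critSet d F) p) ∧
    ∃ c : Circle → M, Manifold.IsSmoothEmbedding (𝓡 1) (𝓡 d) ∞ c ∧ Set.range c = γ

/-- The critical circle `γ` of `F` has index `n`: at each of its points the Hessian has index `n`.
Since the directions tangent to `γ` lie in the kernel of the Hessian, this is the index of the
restriction of `F` to a small disc normal to `γ`. -/
def CircleHasIndex (d : ℕ) {M : Type*} [TopologicalSpace M]
    [ChartedSpace (EuclideanSpace ℝ (Fin d)) M] (F : M → ℝ) (γ : Set M) (n : ℕ) : Prop :=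
  ∀ p ∈ γ, index d F p = n

end

end Bott

/-! The new function is `F + ε h`, where `h` vanishes outside a compact neighborhood `K` of γ inside
`U` and restricts to the height function cos t on γ. Since dF = 0 along γ, a point of γ is critical
for the sum exactly when dh vanishes there. This forces sin t = 0 and leaves the angles 0 and π.
Near these two points `h` is taken constant along normal slices, so all of dh vanishes at them and
the Hessian of `h` is -cos t times the square of the coordinate along γ. This square fills in
exactly the kernel of the Hessian of `F`: the sum becomes nondegenerate, and the index rises by one
where cos t = 1 and is unchanged where cos t = -1 (`sigNeg_add_sq_of_neg`,
`sigNeg_add_sq_of_nonneg`).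

That no critical points appear off γ, although γ is degenerate, is the estimate
`eventually_eq_of_fderiv_add_smul_eq_zero`. At y = x + v with x on γ and v normal, normal
nondegeneracy gives ‖dF(y)‖ ≥ (b - η)‖v‖, while the part of dF(y) tangent to γ is o(‖v‖). If dF(y) =
-ε dh(y), the tangential part of ε dh(x) is then a small multiple of ‖v‖. When ‖dh(x)‖ is at most C
times its tangential part, all of ε dh(y) is equally small, so v = 0. Such a C exists near every
point of γ: where sin t ≠ 0 the tangential part is nonzero, and where sin t = 0 the form dh is
purely tangential on γ by the choice of slices. At the other points of `K` one has dF ≠ 0, which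
survives small perturbations; compactness of `K` then gives one ε.

The slices come from charts adapted to γ (`IsBott.nonempty_circleChart`), and `h` is patched from
local pieces by `exists_contMDiff_extension`. The isolation of γ holds because the critical set is
locally a linear subspace, hence locally connected. -/

namespace Bott

/-! ### Negative index of a quadratic form under a rank-one change. -/

section Algebra

variable {V : Type*} [AddCommGroup V] [Module ℝ V]

lemma posDef_neg_restrict_iff {Q : QuadraticForm ℝ V} {W : Submodule ℝ V} :
    ((-Q).restrict W).PosDef ↔ ∀ x ∈ W, x ≠ 0 → Q x < 0 := by
  simp [QuadraticMap.PosDef]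

variable [FiniteDimensional ℝ V] {Q Q' : QuadraticForm ℝ V} {l : V →ₗ[ℝ] ℝ} {u : V} {k : ℝ}

/-- Adding a nonnegative multiple of the square of a linear form to a quadratic form that does not
depend on a complementary direction does not change the negative index. -/
lemma sigNeg_add_sq_of_nonneg (hu : l u = 1) (hQ : ∀ x, Q (x - l x • u) = Q x)
    (hQ' : ∀ x, Q' x = Q x + k * l x ^ 2) (hk : 0 ≤ k) : sigNeg Q' = sigNeg Q := by
  apply le_antisymm
  · obtain ⟨W, hW, hneg⟩ := exists_finrank_eq_sigNeg_and_negDef Q'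
    rw [← hW]
    refine le_sigNeg_of_negDef Q (posDef_neg_restrict_iff.2 fun x hx hx0 ↦ ?_)
    have := posDef_neg_restrict_iff.1 hneg x hx hx0
    rw [hQ'] at this
    nlinarith [mul_nonneg hk (sq_nonneg (l x))]
  · obtain ⟨W, hW, hneg⟩ := exists_finrank_eq_sigNeg_and_negDef Q
    rw [posDef_neg_restrict_iff] at hneg
    -- Projection to `ker l` along `u`. It preserves `Q`, hence is injective on `W`, and on its
    -- image `Q'` and `Q` agree.
    let p : V →ₗ[ℝ] V := LinearMap.id - l.smulRight u
    have hp (x : V) : p x = x - l x • u := by simp [p]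
    have hinj : Function.Injective (p.domRestrict W) := by
      rw [← LinearMap.ker_eq_bot, LinearMap.ker_eq_bot']
      rintro ⟨x, hx⟩ h0
      by_contra hne
      have h1 : p x = 0 := by simpa using h0
      have := hneg x hx (by simpa using hne)
      rw [← hQ x, ← hp, h1, QuadraticMap.map_zero] at this
      exact lt_irrefl _ this
    rw [← hW, ← LinearMap.finrank_range_of_inj hinj]
    refine le_sigNeg_of_negDef Q' (posDef_neg_restrict_iff.2 ?_)
    rintro _ ⟨⟨x, hx⟩, rfl⟩ h0
    have hx0 : x ≠ 0 := by
      rintro rfl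
      simp at h0
    have hl : l (p x) = 0 := by simp [hp, hu]
    have := hneg x hx hx0
    simp only [LinearMap.domRestrict_apply]
    rw [hQ', hl, hp, hQ]
    simpa using this

/-- Adding a negative multiple of the square of a linear form to a quadratic form that does not
depend on a complementary direction increases the negative index by one. -/
lemma sigNeg_add_sq_of_neg (hu : l u = 1) (hQ : ∀ x, Q (x - l x • u) = Q x)
    (hQ' : ∀ x, Q' x = Q x + k * l x ^ 2) (hk : k < 0) : sigNeg Q' = sigNeg Q + 1 := by
  have hu0 : u ≠ 0 := by
    rintro rfl
    simp at hu
  apply le_antisymm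
  · obtain ⟨W, hW, hneg⟩ := exists_finrank_eq_sigNeg_and_negDef Q'
    rw [posDef_neg_restrict_iff] at hneg
    -- Rank-nullity for `l` on `W`: the rank is at most 1, and on the kernel `Q' = Q` is negative
    -- definite.
    rw [← hW, ← LinearMap.finrank_range_add_finrank_ker (l.domRestrict W), add_comm]
    have h1 : Module.finrank ℝ (LinearMap.range (l.domRestrict W)) ≤ 1 := by
      simpa using Submodule.finrank_le (LinearMap.range (l.domRestrict W))
    have h2 : Module.finrank ℝ (LinearMap.ker (l.domRestrict W)) ≤ sigNeg Q := by
      rw [← Submodule.finrank_map_subtype_eq W (LinearMap.ker (l.domRestrict W))]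
      refine le_sigNeg_of_negDef Q (posDef_neg_restrict_iff.2 ?_)
      rintro _ ⟨⟨x, hx⟩, hx', rfl⟩ h0
      have hlx : l x = 0 := by simpa using hx'
      have := hneg x hx (by simpa using h0)
      rw [hQ', hlx] at this
      simpa using this
    omega
  · obtain ⟨W, hW, hneg⟩ := exists_finrank_eq_sigNeg_and_negDef Q
    rw [posDef_neg_restrict_iff] at hneg
    let p : V →ₗ[ℝ] V := LinearMap.id - l.smulRight u
    have hp (x : V) : p x = x - l x • u := by simp [p]
    -- The new negative space is the projection of `W` to `ker l` together with the line of `u`.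
    let q : W × ℝ →ₗ[ℝ] V := (p.domRestrict W).coprod (LinearMap.toSpanSingleton ℝ V u)
    have hq (x : W) (t : ℝ) : q (x, t) = p x + t • u := by simp [q]
    have hlq (x : W) (t : ℝ) : l (q (x, t)) = t := by simp [hq, hp, hu]
    have hQq (x : W) (t : ℝ) : Q (q (x, t)) = Q x := by
      rw [← hQ, hlq, hq, add_sub_cancel_right, hp, hQ]
    have hneg' (x : W) (t : ℝ) (h : (x, t) ≠ 0) : Q' (q (x, t)) < 0 := by
      rw [hQ', hlq, hQq]
      by_cases hx : x = 0
      · subst hx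
        have ht : t ≠ 0 := by
          rintro rfl
          exact h rfl
        have := mul_neg_of_neg_of_pos hk (pow_pos (abs_pos.2 ht) 2)
        simpa using this
      · have := hneg x x.2 (by simpa using hx)
        nlinarith [mul_nonneg (neg_nonneg.2 hk.le) (sq_nonneg t)]
    have hinj : Function.Injective q := by
      rw [← LinearMap.ker_eq_bot, LinearMap.ker_eq_bot']
      rintro ⟨x, t⟩ h0
      by_contra hne
      have := hneg' x t hne
      rw [h0, QuadraticMap.map_zero] at this
      exact lt_irrefl _ this
    have : Module.finrank ℝ (LinearMap.range q) = sigNeg Q + 1 := by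
      rw [LinearMap.finrank_range_of_inj hinj, Module.finrank_prod, hW, Module.finrank_self]
    rw [← this]
    refine le_sigNeg_of_negDef Q' (posDef_neg_restrict_iff.2 ?_)
    rintro _ ⟨⟨x, t⟩, rfl⟩ h0
    exact hneg' x t fun h ↦ h0 (by rw [h, map_zero])

end Algebra

/-! ### Second derivatives and critical points of small perturbations. -/

section Calculus

variable {E E' : Type*} [NormedAddCommGroup E] [NormedSpace ℝ E] [NormedAddCommGroup E']
  [NormedSpace ℝ E']

/-- The chain rule for the second derivative at a critical point. -/
lemma fderiv_fderiv_comp_of_fderiv_eq_zero {f : E → ℝ} {τ : E' → E} {a : E'}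
    (hf : ContDiffAt ℝ 2 f (τ a)) (hτ : ContDiffAt ℝ 2 τ a) (h0 : fderiv ℝ f (τ a) = 0)
    (u v : E') :
    fderiv ℝ (fderiv ℝ (f ∘ τ)) a u v =
      fderiv ℝ (fderiv ℝ f) (τ a) (fderiv ℝ τ a u) (fderiv ℝ τ a v) := by
  have hf' : ∀ᶠ y in 𝓝 (τ a), DifferentiableAt ℝ f y :=
    (hf.eventually (by simp)).mono fun y hy ↦ hy.differentiableAt (by simp)
  have hτ' : ∀ᶠ y in 𝓝 a, DifferentiableAt ℝ τ y :=
    (hτ.eventually (by simp)).mono fun y hy ↦ hy.differentiableAt (by simp)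
  have heq : fderiv ℝ (f ∘ τ) =ᶠ[𝓝 a] fun x ↦ (fderiv ℝ f (τ x)).comp (fderiv ℝ τ x) := by
    filter_upwards [hτ.continuousAt.eventually hf', hτ'] with x h1 h2
    exact fderiv_comp x h1 h2
  have h1 : HasFDerivAt (fderiv ℝ f) (fderiv ℝ (fderiv ℝ f) (τ a)) (τ a) :=
    ((hf.fderiv_right (m := 1) (by norm_num)).differentiableAt (by simp)).hasFDerivAt
  have h2 : HasFDerivAt (fderiv ℝ τ) (fderiv ℝ (fderiv ℝ τ) a) a :=
    ((hτ.fderiv_right (m := 1) (by norm_num)).differentiableAt (by simp)).hasFDerivAt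
  have h3 := (h1.comp a hτ'.self_of_nhds.hasFDerivAt).clm_comp h2
  rw [heq.fderiv_eq]
  erw [h3.fderiv]
  -- The term containing the second derivative of `τ` is multiplied by df, which is zero here.
  simp [h0]

/-- Near a point where `df ≠ 0`, small perturbations of `f` have no critical points. -/
lemma eventually_fderiv_add_smul_ne_zero {f h : E → ℝ} {a : E} (hf : ContDiffAt ℝ 2 f a)
    (hh : ContDiffAt ℝ 2 h a) (h0 : fderiv ℝ f a ≠ 0) :
    ∀ᶠ z in 𝓝[>] (0 : ℝ) ×ˢ 𝓝 a, fderiv ℝ f z.2 + z.1 • fderiv ℝ h z.2 ≠ 0 := by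
  have h1 : ContinuousAt (fderiv ℝ f) a :=
    (hf.fderiv_right (m := 1) (by norm_num)).continuousAt
  have h2 : ContinuousAt (fderiv ℝ h) a :=
    (hh.fderiv_right (m := 1) (by norm_num)).continuousAt
  have h3 : ContinuousAt (fun z : ℝ × E ↦ fderiv ℝ f z.2 + z.1 • fderiv ℝ h z.2) (0, a) :=
    (h1.comp (f := Prod.snd) (x := ((0 : ℝ), a)) continuousAt_snd).add
      (continuousAt_fst.smul (h2.comp (f := Prod.snd) (x := ((0 : ℝ), a)) continuousAt_snd))
  have h4 : ∀ᶠ z in 𝓝 ((0 : ℝ), a), fderiv ℝ f z.2 + z.1 • fderiv ℝ h z.2 ≠ 0 :=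
    h3.eventually_ne (by simpa using h0)
  rw [nhds_prod_eq] at h4
  exact h4.filter_mono (Filter.prod_mono_left _ nhdsWithin_le_nhds)

/-- Let the critical points of `f` near `a` contain the affine subspace through `a` with projection
`P`, and let the Hessian of `f` at `a` be nondegenerate normally to it. If the differential of `h`
along the subspace is controlled by its tangential part, then critical points of small
perturbations `f + ε h` near `a` lie on the subspace. -/
lemma eventually_eq_of_fderiv_add_smul_eq_zero {f h : E → ℝ} {a : E} {P : E →L[ℝ] E}
    (hf : ContDiffAt ℝ 2 f a) (hh : ContDiffAt ℝ 2 h a) (hP : ∀ x, P (P x) = P x)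
    (hcrit : ∀ᶠ x in 𝓝 a, fderiv ℝ f (a + P (x - a)) = 0)
    {b : ℝ} (hb : 0 < b) (hA : ∀ v, P v = 0 → b * ‖v‖ ≤ ‖fderiv ℝ (fderiv ℝ f) a v‖)
    {C : ℝ} (hC : 0 ≤ C) (hCh : ∀ᶠ x in 𝓝 a,
      ‖fderiv ℝ h (a + P (x - a))‖ ≤ C * ‖(fderiv ℝ h (a + P (x - a))).comp P‖) :
    ∀ᶠ z in 𝓝[>] (0 : ℝ) ×ˢ 𝓝 a, fderiv ℝ f z.2 + z.1 • fderiv ℝ h z.2 = 0 →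
      z.2 = a + P (z.2 - a) := by
  set A := fderiv ℝ (fderiv ℝ f) a with hAdef
  have hsymm : ∀ v w, A v w = A w v := fun v w ↦
    (hf.isSymmSndFDerivAt (by simp)).eq v w
  have h1 : HasStrictFDerivAt (fderiv ℝ f) A a :=
    (hf.fderiv_right (m := 1) (by norm_num)).hasStrictFDerivAt (by simp)
  have h2 : HasStrictFDerivAt (fderiv ℝ h) (fderiv ℝ (fderiv ℝ h) a) a :=
    (hh.fderiv_right (m := 1) (by norm_num)).hasStrictFDerivAt (by simp)
  -- df vanishes on the affine subspace near `a`, so its derivative kills the directions of that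
  -- subspace.
  have hAP (v : E) : A (P v) = 0 := by
    have hτ : HasFDerivAt (fun x ↦ a + P (x - a)) P a := by
      simpa using (P.hasFDerivAt.comp a ((hasFDerivAt_id a).sub_const a)).const_add a
    have hd : HasFDerivAt (fderiv ℝ f ∘ fun x ↦ a + P (x - a)) (A.comp P) a :=
      HasFDerivAt.comp a (by simpa using h1.hasFDerivAt) hτ
    have hz : HasFDerivAt (fderiv ℝ f ∘ fun x ↦ a + P (x - a)) (0 : E →L[ℝ] E →L[ℝ] ℝ) a :=
      (hasFDerivAt_const (0 : E →L[ℝ] ℝ) a).congr_of_eventuallyEq hcrit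
    exact DFunLike.congr_fun (hd.unique hz) v
  obtain ⟨L, hL, hLh⟩ : ∃ L : ℝ, 0 ≤ L ∧ ∀ᶠ z : E × E in 𝓝 (a, a),
      ‖fderiv ℝ h z.1 - fderiv ℝ h z.2‖ ≤ L * ‖z.1 - z.2‖ := by
    obtain ⟨L, hL, hLb⟩ := h2.isBigO_sub.exists_nonneg
    exact ⟨L, hL, hLb.bound⟩
  set K := ‖P‖
  have hK : 0 ≤ K := norm_nonneg _
  -- `η` bounds the error of linearizing df. The strict inequality leaves room for the terms of
  -- order `ε` added next.
  obtain ⟨η, hη, hηb⟩ : ∃ η : ℝ, 0 < η ∧ η * (1 + C * K) < b := by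
    have : 0 < 1 + C * K := by positivity
    refine ⟨b / (1 + C * K) / 2, by positivity, ?_⟩
    field_simp
    linarith
  have hε : ∀ᶠ ε in 𝓝[>] (0 : ℝ), 0 < ε ∧ η * (1 + C * K) + ε * (C * L * K + L) < b := by
    have hpos : ∀ᶠ ε in 𝓝[>] (0 : ℝ), 0 < ε := self_mem_nhdsWithin
    refine hpos.and (Filter.Eventually.filter_mono nhdsWithin_le_nhds ?_)
    have : ContinuousAt (fun ε : ℝ ↦ η * (1 + C * K) + ε * (C * L * K + L)) 0 := by fun_prop
    exact this.eventually_lt continuousAt_const (by simpa using hηb)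
  have hpair : Filter.Tendsto (fun y ↦ (y, a + P (y - a))) (𝓝 a) (𝓝 (a, a)) := by
    have : ContinuousAt (fun y ↦ (y, a + P (y - a))) a := by fun_prop
    simpa [ContinuousAt] using this
  -- Strict differentiability is needed: df is compared at `y` and at its projection, and both
  -- points vary.
  filter_upwards [hε.prod_mk (((hpair.eventually (h1.isLittleO.bound hη)).and
    (hpair.eventually hLh)).and (hcrit.and hCh))]
  rintro ⟨ε, y⟩ ⟨⟨hε0, hεb⟩, ⟨hy1, hy2⟩, hy3, hy4⟩ hy
  simp only at hε0 hεb hy1 hy2 hy3 hy4 hy ⊢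
  set x := a + P (y - a) with hx
  set v := y - x with hv
  have hPv : P v = 0 := by simp [hv, hx, hP]
  by_contra hne
  have hv0 : 0 < ‖v‖ := norm_pos_iff.2 (sub_ne_zero.2 hne)
  rw [hy3, sub_zero] at hy1
  have hDf : b * ‖v‖ - η * ‖v‖ ≤ ‖fderiv ℝ f y‖ := by
    have := norm_le_norm_add_norm_sub' (A v) (fderiv ℝ f y)
    rw [norm_sub_rev] at this
    linarith [hA v hPv]
  -- By symmetry of the Hessian, `A v` vanishes on the range of `P`, so only the linearization error
  -- has a tangential part.
  have hDfP : ‖(fderiv ℝ f y).comp P‖ ≤ η * ‖v‖ * K := by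
    have : (fderiv ℝ f y).comp P = (fderiv ℝ f y - A v).comp P := by
      ext w
      simp [hsymm v, hAP]
    rw [this]
    exact (ContinuousLinearMap.opNorm_comp_le _ _).trans (by gcongr)
  have hDh : ‖fderiv ℝ f y‖ = ε * ‖fderiv ℝ h y‖ := by
    rw [eq_neg_of_add_eq_zero_left hy, norm_neg, norm_smul, Real.norm_of_nonneg hε0.le]
  have hDhP : ‖(fderiv ℝ f y).comp P‖ = ε * ‖(fderiv ℝ h y).comp P‖ := by
    rw [eq_neg_of_add_eq_zero_left hy, ContinuousLinearMap.neg_comp, norm_neg,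
      ContinuousLinearMap.smul_comp, norm_smul, Real.norm_of_nonneg hε0.le]
  have h5 : ‖(fderiv ℝ h x).comp P‖ ≤ ‖(fderiv ℝ h y).comp P‖ + L * ‖v‖ * K := by
    have : ‖(fderiv ℝ h y - fderiv ℝ h x).comp P‖ ≤ L * ‖v‖ * K :=
      (ContinuousLinearMap.opNorm_comp_le _ _).trans (by gcongr)
    rw [ContinuousLinearMap.sub_comp] at this
    linarith [norm_le_norm_add_norm_sub ((fderiv ℝ h y).comp P) ((fderiv ℝ h x).comp P)]
  have h6 : ‖fderiv ℝ h y‖ ≤ ‖fderiv ℝ h x‖ + L * ‖v‖ := by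
    linarith [norm_le_norm_add_norm_sub' (fderiv ℝ h y) (fderiv ℝ h x)]
  have h7 : ε * ‖(fderiv ℝ h x).comp P‖ ≤ η * ‖v‖ * K + ε * (L * ‖v‖ * K) := by
    calc _ ≤ ε * (‖(fderiv ℝ h y).comp P‖ + L * ‖v‖ * K) := by gcongr
      _ ≤ _ := by rw [mul_add, ← hDhP]; gcongr
  have h8 : ε * ‖fderiv ℝ h x‖ ≤ C * (η * ‖v‖ * K + ε * (L * ‖v‖ * K)) := by
    calc _ ≤ ε * (C * ‖(fderiv ℝ h x).comp P‖) := by gcongr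
      _ = C * (ε * ‖(fderiv ℝ h x).comp P‖) := by ring
      _ ≤ _ := by gcongr
  have h9 : ε * ‖fderiv ℝ h y‖ ≤ C * (η * ‖v‖ * K + ε * (L * ‖v‖ * K)) + ε * (L * ‖v‖) := by
    calc _ ≤ ε * (‖fderiv ℝ h x‖ + L * ‖v‖) := by gcongr
      _ ≤ _ := by rw [mul_add]; gcongr
  -- The bounds combine to b‖v‖ ≤ (η(1 + CK) + ε(CLK + L))‖v‖, against the choice of `ε`.
  have h10 := mul_lt_mul_of_pos_right hεb hv0
  nlinarith

/-- If `h` is invariant under the affine projection `x ↦ a + P (x - a)` near `a`, then its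
differential on the image is determined by its tangential part. -/
lemma eventually_fderiv_comp_eq {h : E → ℝ} {a : E} {P : E →L[ℝ] E} (hh : ContDiffAt ℝ 2 h a)
    (hP : ∀ x, P (P x) = P x) (hinv : ∀ᶠ x in 𝓝 a, h x = h (a + P (x - a))) :
    ∀ᶠ x in 𝓝 a, (fderiv ℝ h (a + P (x - a))).comp P = fderiv ℝ h (a + P (x - a)) := by
  have hdiff : ∀ᶠ y in 𝓝 a, DifferentiableAt ℝ h y :=
    (hh.eventually (by simp)).mono fun y hy ↦ hy.differentiableAt (by simp)
  have hcont : Filter.Tendsto (fun x ↦ a + P (x - a)) (𝓝 a) (𝓝 a) := by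
    have : ContinuousAt (fun x ↦ a + P (x - a)) a := by fun_prop
    simpa [ContinuousAt] using this
  filter_upwards [hcont.eventually hdiff, hcont.eventually (eventually_eventually_nhds.2 hinv)]
    with x h1 h2
  set y := a + P (x - a) with hy
  have hτy : a + P (y - a) = y := by simp [hy, hP]
  have hτ : HasFDerivAt (fun x ↦ a + P (x - a)) P y := by
    simpa using (P.hasFDerivAt.comp y ((hasFDerivAt_id y).sub_const a)).const_add a
  have hd : HasFDerivAt (h ∘ fun x ↦ a + P (x - a)) ((fderiv ℝ h y).comp P) y :=
    HasFDerivAt.comp y (by rw [hτy]; exact h1.hasFDerivAt) hτ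
  exact (hd.congr_of_eventuallyEq h2).fderiv.symm

end Calculus

/-! ### Critical points, Hessian and index in arbitrary charts. -/

section Charts

variable {d : ℕ} {M : Type*} [TopologicalSpace M]

lemma hessianIn_congr {F G : M → ℝ} {p : M}
    {e : OpenPartialHomeomorph M (EuclideanSpace ℝ (Fin d))} (hp : p ∈ e.source) (h : F =ᶠ[𝓝 p] G) :
    hessianIn e F p = hessianIn e G p := by
  have h1 : F ∘ e.symm =ᶠ[𝓝 (e p)] G ∘ e.symm := by
    have : Filter.Tendsto e.symm (𝓝 (e p)) (𝓝 p) := by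
      simpa [ContinuousAt, e.left_inv hp] using e.symm.continuousAt (e.map_source hp)
    exact this.eventually h
  unfold hessianIn
  rw [(h1.fderiv (𝕜 := ℝ)).fderiv_eq]

lemma hessianIn_apply (e : OpenPartialHomeomorph M (EuclideanSpace ℝ (Fin d))) (F : M → ℝ) (p : M)
    (v w : EuclideanSpace ℝ (Fin d)) :
    hessianIn e F p v w = fderiv ℝ (fderiv ℝ (F ∘ e.symm)) (e p) v w := rfl

variable [ChartedSpace (EuclideanSpace ℝ (Fin d)) M]
  {F G : M → ℝ} {p : M} {e e' : OpenPartialHomeomorph M (EuclideanSpace ℝ (Fin d))}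

lemma contDiffAt_comp_symm {n : ℕ∞ω} (he : e ∈ IsManifold.maximalAtlas (𝓡 d) n M)
    (hp : p ∈ e.source) (hF : ContMDiffAt (𝓡 d) 𝓘(ℝ, ℝ) n F p) :
    ContDiffAt ℝ n (F ∘ e.symm) (e p) := by
  rw [← contMDiffAt_iff_contDiffAt]
  refine ContMDiffAt.comp (e p) (I' := 𝓡 d) ?_
    (contMDiffAt_symm_of_mem_maximalAtlas he (e.map_source hp))
  rwa [e.left_inv hp]

/-- Critical points can be computed in any chart. -/
lemma mem_critSet_iff (he : e ∈ IsManifold.maximalAtlas (𝓡 d) ∞ M) (hp : p ∈ e.source)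
    (hF : ContMDiffAt (𝓡 d) 𝓘(ℝ, ℝ) ∞ F p) :
    p ∈ critSet d F ↔ fderiv ℝ (F ∘ e.symm) (e p) = 0 := by
  have h1 : MDifferentiableAt (𝓡 d) 𝓘(ℝ, ℝ) F p := hF.mdifferentiableAt (by simp)
  have h2 : MDifferentiableAt (𝓡 d) (𝓡 d) e.symm (e p) :=
    (contMDiffAt_symm_of_mem_maximalAtlas he (e.map_source hp)).mdifferentiableAt (by simp)
  have h3 : MDifferentiableAt (𝓡 d) (𝓡 d) e p :=
    (contMDiffAt_of_mem_maximalAtlas he hp).mdifferentiableAt (by simp)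
  have h1' : MDifferentiableAt (𝓡 d) 𝓘(ℝ, ℝ) F (e.symm (e p)) := by rwa [e.left_inv hp]
  have h4 : MDifferentiableAt (𝓡 d) 𝓘(ℝ, ℝ) (F ∘ e.symm) (e p) := h1'.comp (e p) h2
  rw [← mfderiv_eq_fderiv]
  constructor
  · intro h
    have h : mfderiv (𝓡 d) 𝓘(ℝ, ℝ) F (e.symm (e p)) = 0 := by
      rw [e.left_inv hp]
      exact h
    rw [mfderiv_comp (e p) h1' h2, h]
    exact ContinuousLinearMap.zero_comp _
  · intro h
    have heq : F =ᶠ[𝓝 p] (F ∘ e.symm) ∘ e := by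
      filter_upwards [e.open_source.mem_nhds hp] with y hy
      simp [e.left_inv hy]
    change mfderiv (𝓡 d) 𝓘(ℝ, ℝ) F p = 0
    rw [heq.mfderiv_eq, mfderiv_comp p h4 h3, h]
    exact ContinuousLinearMap.zero_comp _

lemma mem_critSet_congr (h : F =ᶠ[𝓝 p] G) : p ∈ critSet d F ↔ p ∈ critSet d G := by
  change mfderiv (𝓡 d) 𝓘(ℝ, ℝ) F p = 0 ↔ mfderiv (𝓡 d) 𝓘(ℝ, ℝ) G p = 0
  rw [h.mfderiv_eq]
  rfl

lemma hessianIn_symm (he : e ∈ IsManifold.maximalAtlas (𝓡 d) ∞ M)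
    (hp : p ∈ e.source) (hF : ContMDiffAt (𝓡 d) 𝓘(ℝ, ℝ) ∞ F p)
    (v w : EuclideanSpace ℝ (Fin d)) : hessianIn e F p v w = hessianIn e F p w v :=
  ((contDiffAt_comp_symm he hp hF).isSymmSndFDerivAt
    (by simp only [minSmoothness_of_isRCLikeNormedField]; norm_cast)).eq v w

/-- Hessians at a critical point in two charts are congruent. -/
lemma exists_hessianIn_congr (he : e ∈ IsManifold.maximalAtlas (𝓡 d) ∞ M)
    (he' : e' ∈ IsManifold.maximalAtlas (𝓡 d) ∞ M) (hp : p ∈ e.source) (hp' : p ∈ e'.source)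
    (hF : ContMDiffAt (𝓡 d) 𝓘(ℝ, ℝ) ∞ F p) (hcrit : p ∈ critSet d F) :
    ∃ T : EuclideanSpace ℝ (Fin d) ≃ₗ[ℝ] EuclideanSpace ℝ (Fin d),
      ∀ v w, hessianIn e' F p v w = hessianIn e F p (T v) (T w) := by
  have hτ : ∀ {e e' : OpenPartialHomeomorph M (EuclideanSpace ℝ (Fin d))},
      e ∈ IsManifold.maximalAtlas (𝓡 d) ∞ M → e' ∈ IsManifold.maximalAtlas (𝓡 d) ∞ M →
      p ∈ e.source → p ∈ e'.source → ContDiffAt ℝ ∞ (e ∘ e'.symm) (e' p) := by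
    intro e e' he he' hp hp'
    rw [← contMDiffAt_iff_contDiffAt]
    refine ContMDiffAt.comp (e' p) (I' := 𝓡 d) ?_
      (contMDiffAt_symm_of_mem_maximalAtlas he' (e'.map_source hp'))
    rw [e'.left_inv hp']
    exact contMDiffAt_of_mem_maximalAtlas he hp
  have hinv : ∀ {e e' : OpenPartialHomeomorph M (EuclideanSpace ℝ (Fin d))},
      p ∈ e.source → p ∈ e'.source →
      (e ∘ e'.symm) ∘ (e' ∘ e.symm) =ᶠ[𝓝 (e p)] id := by
    intro e e' hp hp'
    have h1 : Filter.Tendsto e.symm (𝓝 (e p)) (𝓝 p) := by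
      simpa [ContinuousAt, e.left_inv hp] using e.symm.continuousAt (e.map_source hp)
    filter_upwards [h1.eventually (e'.open_source.mem_nhds hp'),
      e.open_target.mem_nhds (e.map_source hp)] with y hy hy'
    simp [e'.left_inv hy, e.right_inv hy']
  have hcomp : ∀ {e e' : OpenPartialHomeomorph M (EuclideanSpace ℝ (Fin d))},
      e ∈ IsManifold.maximalAtlas (𝓡 d) ∞ M → e' ∈ IsManifold.maximalAtlas (𝓡 d) ∞ M →
      p ∈ e.source → p ∈ e'.source →
      (fderiv ℝ (e ∘ e'.symm) (e' p)).comp (fderiv ℝ (e' ∘ e.symm) (e p)) =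
        ContinuousLinearMap.id ℝ _ := by
    intro e e' he he' hp hp'
    have h1 := (hinv hp hp').fderiv_eq (𝕜 := ℝ)
    have hpt : (e' ∘ e.symm) (e p) = e' p := by simp [e.left_inv hp]
    rw [fderiv_comp _ (by rw [hpt]; exact (hτ he he' hp hp').differentiableAt (by simp))
      ((hτ he' he hp' hp).differentiableAt (by simp)), hpt, fderiv_id] at h1
    exact h1
  -- The congruence is the differential of the transition map.
  refine ⟨(ContinuousLinearEquiv.equivOfInverse (fderiv ℝ (e ∘ e'.symm) (e' p))
    (fderiv ℝ (e' ∘ e.symm) (e p)) (DFunLike.congr_fun (hcomp he' he hp' hp))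
    (DFunLike.congr_fun (hcomp he he' hp hp'))).toLinearEquiv, fun v w ↦ ?_⟩
  have hpt : (e ∘ e'.symm) (e' p) = e p := by simp [e'.left_inv hp']
  have heq : F ∘ e'.symm =ᶠ[𝓝 (e' p)] (F ∘ e.symm) ∘ (e ∘ e'.symm) := by
    have h1 : Filter.Tendsto e'.symm (𝓝 (e' p)) (𝓝 p) := by
      simpa [ContinuousAt, e'.left_inv hp'] using e'.symm.continuousAt (e'.map_source hp')
    filter_upwards [h1.eventually (e.open_source.mem_nhds hp)] with y hy
    simp [e.left_inv hy]
  rw [hessianIn_apply, hessianIn_apply, (heq.fderiv (𝕜 := ℝ)).fderiv_eq,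
    fderiv_fderiv_comp_of_fderiv_eq_zero, hpt]
  · rfl
  · rw [hpt]
    exact (contDiffAt_comp_symm he hp hF).of_le (by norm_cast)
  · exact (hτ he he' hp hp').of_le (by norm_cast)
  · rw [hpt]
    exact (mem_critSet_iff he hp hF).1 hcrit

/-- The normal form of a critical set around `p` required of a Bott function. -/
def IsBottAt (d : ℕ) {M : Type*} [TopologicalSpace M] [ChartedSpace (EuclideanSpace ℝ (Fin d)) M]
    (F : M → ℝ) (p : M) : Prop :=
  ∃ e ∈ IsManifold.maximalAtlas (𝓡 d) ∞ M, p ∈ e.source ∧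
    ∃ S : Submodule ℝ (EuclideanSpace ℝ (Fin d)),
      (∀ x ∈ e.source, x ∈ critSet d F ↔ e x - e p ∈ S) ∧
      ∀ N : Submodule ℝ (EuclideanSpace ℝ (Fin d)), IsCompl S N →
        ((hessianIn e F p).restrict N).Nondegenerate

lemma IsBottAt.congr (h : IsBottAt d F p) (hFG : F =ᶠ[𝓝 p] G) : IsBottAt d G p := by
  obtain ⟨e, he, hp, S, hS, hN⟩ := h
  obtain ⟨s, hs, hso, hps⟩ := eventually_nhds_iff.1 (eventually_eventually_nhds.2 hFG)
  have hps' : p ∈ (e.restr s).source := by simp [hp, hso.interior_eq, hps]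
  refine ⟨e.restr s, restr_mem_maximalAtlas _ he hso, hps', S, fun x hx ↦ ?_, fun N hSN ↦ ?_⟩
  · simp only [OpenPartialHomeomorph.restr_source, hso.interior_eq] at hx
    rw [← mem_critSet_congr (hs x hx.2)]
    exact hS x hx.1
  · rw [hessianIn_congr hps' hFG.symm]
    exact hN N hSN

variable [IsManifold (𝓡 d) ∞ M]

lemma index_eq_of_mem_maximalAtlas (he : e ∈ IsManifold.maximalAtlas (𝓡 d) ∞ M)
    (hp : p ∈ e.source) (hF : ContMDiffAt (𝓡 d) 𝓘(ℝ, ℝ) ∞ F p) (hcrit : p ∈ critSet d F) :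
    index d F p = sigNeg (LinearMap.BilinMap.toQuadraticMap (hessianIn e F p)) := by
  obtain ⟨T, hT⟩ := exists_hessianIn_congr he (IsManifold.chart_mem_maximalAtlas p) hp
    (mem_chart_source _ p) hF hcrit
  refine QuadraticMap.Equivalent.sigNeg_eq ⟨⟨T, fun m ↦ ?_⟩⟩
  exact (hT m m).symm

lemma hessian_nondegenerate_of_mem_maximalAtlas (he : e ∈ IsManifold.maximalAtlas (𝓡 d) ∞ M)
    (hp : p ∈ e.source) (hF : ContMDiffAt (𝓡 d) 𝓘(ℝ, ℝ) ∞ F p) (hcrit : p ∈ critSet d F)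
    (hnd : (hessianIn e F p).Nondegenerate) : (hessian d F p).Nondegenerate := by
  obtain ⟨T, hT⟩ := exists_hessianIn_congr he (IsManifold.chart_mem_maximalAtlas p) hp
    (mem_chart_source _ p) hF hcrit
  have : hessian d F p = LinearMap.BilinForm.congr T.symm (hessianIn e F p) := by
    ext v w
    simp [hessian, hT]
  rw [this]
  exact LinearMap.BilinForm.Nondegenerate.congr _ hnd

/-- Here the critical submanifold is a point: `S = ⊥`, whose only complement is the whole space. -/
lemma isBottAt_of_nondegenerate {k : ℕ} (h : IsNondegenerateCriticalPoint d F p k)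
    (hiso : ∀ᶠ x in 𝓝 p, x ∈ critSet d F → x = p) : IsBottAt d F p := by
  obtain ⟨s, hs, hso, hps⟩ := eventually_nhds_iff.1 hiso
  refine ⟨(chartAt (EuclideanSpace ℝ (Fin d)) p).restr s,
    restr_mem_maximalAtlas _ (IsManifold.chart_mem_maximalAtlas p) hso, ?_, ⊥, fun x hx ↦ ?_,
    fun N hN ↦ ?_⟩
  · simp [hso.interior_eq, hps]
  · simp only [OpenPartialHomeomorph.restr_source, hso.interior_eq] at hx
    rw [Submodule.mem_bot, sub_eq_zero]
    constructor
    · intro hc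
      rw [hs x hx.2 hc]
    · intro hc
      have : x = p := (chartAt (EuclideanSpace ℝ (Fin d)) p).injOn hx.1 (mem_chart_source _ p) hc
      exact this ▸ h.1
  · have hN' : N = ⊤ := by simpa using hN.sup_eq_top
    subst hN'
    have h2 : LinearMap.BilinForm.Nondegenerate (hessian d F p) := h.2.1
    have := LinearMap.BilinForm.Nondegenerate.congr Submodule.topEquiv.symm h2
    exact this

end Charts

/-! ### Isolation of the components of the critical set. -/

section Circle

variable {d : ℕ} {M : Type*} [TopologicalSpace M] [ChartedSpace (EuclideanSpace ℝ (Fin d)) M]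
  {F : M → ℝ}

/-- The critical set of a Bott function is locally connected, so that its connected components
are relatively open. -/
lemma IsBott.eventually_mem_connectedComponentIn (hF : IsBott d F) {p q : M}
    (hp : p ∈ connectedComponentIn (critSet d F) q) :
    ∀ᶠ x in 𝓝 p, x ∈ critSet d F → x ∈ connectedComponentIn (critSet d F) q := by
  obtain ⟨e, he, hpe, S, hS, -⟩ := hF.2 p (connectedComponentIn_subset _ _ hp)
  obtain ⟨r, hr, hball⟩ := Metric.isOpen_iff.1 e.open_target _ (e.map_source hpe)
  set s : Set (EuclideanSpace ℝ (Fin d)) := Metric.ball (e p) r ∩ {y | y - e p ∈ S}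
  -- In the chart the critical points near `p` form a ball cut by an affine subspace, which is
  -- convex.
  have hs : IsPreconnected (e.symm '' s) := by
    refine IsPreconnected.image ?_ _ (e.symm.continuousOn.mono fun y hy ↦ hball hy.1)
    refine (Convex.inter (convex_ball _ _) fun y hy z hz a b _ _ hab ↦ ?_).isPreconnected
    have : a • y + b • z - e p = a • (y - e p) + b • (z - e p) := by
      have : e p = (a + b) • e p := by rw [hab, one_smul]
      nth_rewrite 1 [this]
      module
    change a • y + b • z - e p ∈ S
    rw [this]
    exact S.add_mem (S.smul_mem _ hy) (S.smul_mem _ hz)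
  have hscrit : e.symm '' s ⊆ critSet d F := by
    rintro _ ⟨y, hy, rfl⟩
    rw [hS _ (e.map_target (hball hy.1)), e.right_inv (hball hy.1)]
    exact hy.2
  have hps : p ∈ e.symm '' s := ⟨e p, ⟨Metric.mem_ball_self hr, by simp⟩, e.left_inv hpe⟩
  rw [connectedComponentIn_eq hp]
  filter_upwards [(e.continuousAt hpe).eventually (Metric.ball_mem_nhds _ hr),
    e.open_source.mem_nhds hpe] with x hx hxe hxc
  exact hs.subset_connectedComponentIn hps hscrit
    ⟨e x, ⟨hx, (hS x hxe).1 hxc⟩, e.left_inv hxe⟩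

/-- A connected component of the critical set of a Bott function is isolated in it. -/
lemma IsBott.exists_mem_nhdsSet_inter_critSet (hF : IsBott d F) {q : M}
    {γ : Set M} (hγ : γ = connectedComponentIn (critSet d F) q) :
    ∃ U ∈ 𝓝ˢ γ, U ∩ critSet d F = γ := by
  refine ⟨{x | x ∈ critSet d F → x ∈ γ}, ?_, ?_⟩
  · rw [mem_nhdsSet_iff_forall]
    intro p hp
    subst hγ
    exact hF.eventually_mem_connectedComponentIn hp
  · ext x
    constructor
    · exact fun hx ↦ hx.1 hx.2
    · exact fun hx ↦ ⟨fun _ ↦ hx, connectedComponentIn_subset _ _ (hγ ▸ hx)⟩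

end Circle

/-! ### Charts adapted to a critical circle. -/

section CircleChart

variable {d : ℕ} {M : Type*} [TopologicalSpace M] [ChartedSpace (EuclideanSpace ℝ (Fin d)) M]
  {F : M → ℝ} {c : Circle → M}

/-- The inverse of a smoothly embedded circle extends locally to a smooth function. -/
lemma exists_local_inverse (hc : Manifold.IsSmoothEmbedding (𝓡 1) (𝓡 d) ∞ c) (θ : Circle) :
    ∃ P : M → ℂ, (∀ᶠ y in 𝓝 (c θ), ContMDiffAt (𝓡 d) 𝓘(ℝ, ℂ) ∞ P y) ∧
      ∀ᶠ y in 𝓝 (c θ), ∀ θ', c θ' = y → P y = θ' := by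
  have : Fact (Module.finrank ℝ ℂ = 1 + 1) := Complex.finrank_real_complex_fact
  have him := hc.isImmersion.isImmersionAt θ
  set φ := him.domChart
  set ψ := him.codChart
  have hφ := him.domChart_mem_maximalAtlas
  have hψ := him.codChart_mem_maximalAtlas
  have hθ : θ ∈ φ.source := him.mem_domChart_source
  have hcθ : c θ ∈ ψ.source := him.mem_codChart_source
  -- In immersion charts `c` is x ↦ (x, 0), so the first component recovers the point of the circle.
  have hwr : ∀ θ' ∈ φ.source, him.equiv (φ θ', 0) = ψ (c θ') := by
    intro θ' hθ'
    have hx : φ θ' ∈ (φ.extend (𝓡 1)).target := by simpa using φ.map_source hθ'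
    have := him.writtenInCharts hx
    simpa [φ.left_inv hθ', φ, ψ] using this.symm
  have hq : ∀ θ' ∈ φ.source, (him.equiv.symm (ψ (c θ'))).1 = φ θ' := by
    intro θ' hθ'
    rw [← hwr θ' hθ']
    simp
  refine ⟨fun y ↦ (φ.symm (him.equiv.symm (ψ y)).1 : ℂ), ?_, ?_⟩
  · have hcont : ContinuousAt (fun y ↦ (him.equiv.symm (ψ y)).1) (c θ) :=
      (continuous_fst.comp him.equiv.symm.continuous).continuousAt.comp (ψ.continuousAt hcθ)
    have hmem : ∀ᶠ y in 𝓝 (c θ), (him.equiv.symm (ψ y)).1 ∈ φ.target :=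
      hcont.eventually (φ.open_target.mem_nhds (by
        change (him.equiv.symm (ψ (c θ))).1 ∈ φ.target
        rw [hq θ hθ]
        exact φ.map_source hθ))
    filter_upwards [hmem, ψ.open_source.mem_nhds hcθ] with y hy hyψ
    have h1 : ContMDiffAt (𝓡 1) 𝓘(ℝ, ℂ) ∞ (fun θ : Circle ↦ (θ : ℂ))
        (φ.symm (him.equiv.symm (ψ y)).1) :=
      (contMDiff_coe_sphere (E := ℂ) (n := 1)).contMDiffAt
    have h2 : ContMDiffAt (𝓡 1) (𝓡 1) ∞ φ.symm (him.equiv.symm (ψ y)).1 :=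
      contMDiffAt_symm_of_mem_maximalAtlas hφ hy
    have h3 : ContMDiffAt (𝓡 d) (𝓡 1) ∞ (fun y ↦ (him.equiv.symm (ψ y)).1) y := by
      have h4 : ContDiff ℝ ∞ fun v ↦ (him.equiv.symm v).1 :=
        contDiff_fst.comp him.equiv.symm.contDiff
      exact h4.contMDiff.contMDiffAt.comp y (contMDiffAt_of_mem_maximalAtlas hψ hyψ)
    exact h1.comp y (h2.comp y h3)
  -- Since `c` is a topological embedding, every point of the circle with image near `c θ` lies in
  -- the domain chart, not just those known to be close to `θ`.
  · have := φ.open_source.mem_nhds hθ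
    rw [hc.isEmbedding.isInducing.nhds_eq_comap, Filter.mem_comap] at this
    obtain ⟨s, hs, hsφ⟩ := this
    filter_upwards [hs] with y hy θ' hθ'
    subst hθ'
    have hθ' : θ' ∈ φ.source := hsφ hy
    simp [hq θ' hθ', φ.left_inv hθ']

variable (d F c) in
/-- A chart adapted to the critical circle of `F` parametrized by `c`, at the point with angle `t`.
The direction `dir` spans the line to which the circle corresponds in the chart, and the function
`ext` extends the first coordinate function of the circle constantly along `coord = 0`. -/
structure CircleChart (t : ℝ) where
  chart : OpenPartialHomeomorph M (EuclideanSpace ℝ (Fin d))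
  mem_maximalAtlas : chart ∈ IsManifold.maximalAtlas (𝓡 d) ∞ M
  mem_source : c (Circle.exp t) ∈ chart.source
  dir : EuclideanSpace ℝ (Fin d)
  coord : EuclideanSpace ℝ (Fin d) →L[ℝ] ℝ
  coord_dir : coord dir = 1
  hasDerivAt : HasDerivAt (fun s ↦ chart (c (Circle.exp s))) dir t
  mem_critSet_iff_sub_mem : ∀ x ∈ chart.source,
    x ∈ critSet d F ↔ chart x - chart (c (Circle.exp t)) ∈ Submodule.span ℝ {dir}
  nondegenerate : ∀ v, coord v = 0 →
    (∀ w, coord w = 0 → hessianIn chart F (c (Circle.exp t)) v w = 0) → v = 0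
  ext : M → ℝ
  contMDiffAt_ext : ∀ᶠ y in 𝓝 (c (Circle.exp t)), ContMDiffAt (𝓡 d) 𝓘(ℝ, ℝ) ∞ ext y
  ext_eq : ∀ᶠ y in 𝓝 (c (Circle.exp t)), ∀ θ, c θ = y → ext y = (θ : ℂ).re
  ext_proj : ∀ᶠ x in 𝓝 (chart (c (Circle.exp t))), ext (chart.symm x) =
    ext (chart.symm (chart (c (Circle.exp t)) + coord (x - chart (c (Circle.exp t))) • dir))

lemma contDiffAt_chart_circle (hc : Manifold.IsSmoothEmbedding (𝓡 1) (𝓡 d) ∞ c)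
    [IsManifold (𝓡 d) ∞ M]
    {e : OpenPartialHomeomorph M (EuclideanSpace ℝ (Fin d))} {t : ℝ}
    (he : e ∈ IsManifold.maximalAtlas (𝓡 d) ∞ M) (ht : c (Circle.exp t) ∈ e.source) :
    ContDiffAt ℝ ∞ (fun s ↦ e (c (Circle.exp s))) t := by
  rw [← contMDiffAt_iff_contDiffAt]
  exact (contMDiffAt_of_mem_maximalAtlas he ht).comp t
    ((hc.contMDiff (Circle.exp t)).comp t (contMDiff_circleExp t))

lemma mem_span_singleton_iff_of_apply_eq_one {V : Type*} [AddCommGroup V] [Module ℝ V]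
    {l : V →ₗ[ℝ] ℝ} {u : V} (hu : l u = 1) (v : V) : v ∈ Submodule.span ℝ {u} ↔ l v • u = v := by
  rw [Submodule.mem_span_singleton]
  constructor
  · rintro ⟨k, rfl⟩
    simp [hu]
  · exact fun h ↦ ⟨_, h⟩

lemma isCompl_span_singleton_ker {V : Type*} [AddCommGroup V] [Module ℝ V]
    {l : V →ₗ[ℝ] ℝ} {u : V} (hu : l u = 1) :
    IsCompl (Submodule.span ℝ {u}) (LinearMap.ker l) := by
  refine ⟨Submodule.disjoint_def.2 fun x hx hx' ↦ ?_, codisjoint_iff.2 ?_⟩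
  · rw [← (mem_span_singleton_iff_of_apply_eq_one hu x).1 hx, LinearMap.mem_ker.1 hx', zero_smul]
  · refine eq_top_iff.2 fun x _ ↦ ?_
    rw [← add_sub_cancel (l x • u) x]
    refine Submodule.add_mem_sup (Submodule.smul_mem _ _ (Submodule.mem_span_singleton_self u)) ?_
    simp [hu]

/-- The point is that the space `S` of a Bott chart is the line of the velocity `u` of the circle.
Difference quotients lie in the closed subspace `S`, so `u ∈ S`; and `u ≠ 0` because the local
inverse `P` turns the curve into e^{is}. Conversely, for `s ∈ S` the segment a + τ s consists of
critical points, hence lies on γ for small τ; there it is the circle reparametrized by a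
differentiable angle, so its velocity `s` is a multiple of `u`. -/
lemma IsBott.nonempty_circleChart [IsManifold (𝓡 d) ∞ M] (hF : IsBott d F)
    (hγ : IsCriticalCircle d F (Set.range c))
    (hc : Manifold.IsSmoothEmbedding (𝓡 1) (𝓡 d) ∞ c) (t : ℝ) :
    Nonempty (CircleChart d F c t) := by
  obtain ⟨⟨q, -, hq⟩, -⟩ := hγ
  have hcrit (θ : Circle) : c θ ∈ critSet d F :=
    connectedComponentIn_subset _ q (hq ▸ Set.mem_range_self θ)
  obtain ⟨P, hP, hPc⟩ := exists_local_inverse hc (Circle.exp t)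
  set p := c (Circle.exp t) with hp
  obtain ⟨e, he, hpe, S, hS, hN⟩ := hF.2 p (hcrit _)
  set a := e p with ha
  set σ : ℝ → EuclideanSpace ℝ (Fin d) := fun s ↦ e (c (Circle.exp s)) with hσ
  have hσt : σ t = a := rfl
  have hσd : HasDerivAt σ (deriv σ t) t :=
    ((contDiffAt_chart_circle hc he hpe).differentiableAt (by simp)).hasDerivAt
  set u := deriv σ t with hu
  have hcont : Continuous fun s ↦ c (Circle.exp s) :=
    hc.isEmbedding.continuous.comp Circle.exp.continuous
  have hsrc : ∀ᶠ s in 𝓝 t, c (Circle.exp s) ∈ e.source :=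
    hcont.continuousAt.eventually (e.open_source.mem_nhds hpe)
  have hσS : ∀ᶠ s in 𝓝 t, σ s - a ∈ S :=
    hsrc.mono fun s hs ↦ (hS _ hs).1 (hcrit _)
  have huS : u ∈ S := by
    refine S.closed_of_finiteDimensional.mem_of_tendsto (hasDerivAt_iff_tendsto_slope.1 hσd) ?_
    filter_upwards [hσS.filter_mono nhdsWithin_le_nhds] with s hs
    exact S.smul_mem _ hs
  have hsymm : Filter.Tendsto e.symm (𝓝 a) (𝓝 p) := by
    simpa [ContinuousAt, ha, e.left_inv hpe] using e.symm.continuousAt (e.map_source hpe)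
  have hPd : DifferentiableAt ℝ (P ∘ e.symm) a := by
    have h1 : ContMDiffAt 𝓘(ℝ, EuclideanSpace ℝ (Fin d)) 𝓘(ℝ, ℂ) ∞ (P ∘ e.symm) a := by
      refine ContMDiffAt.comp a (I' := 𝓡 d) ?_
        (contMDiffAt_symm_of_mem_maximalAtlas he (e.map_source hpe))
      rw [ha, e.left_inv hpe]
      exact hP.self_of_nhds
    exact (contMDiffAt_iff_contDiffAt.1 h1).differentiableAt (by simp)
  have hu0 : u ≠ 0 := by
    intro h0
    have h1 : HasDerivAt ((P ∘ e.symm) ∘ σ) (fderiv ℝ (P ∘ e.symm) a u) t :=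
      HasFDerivAt.comp_hasDerivAt t hPd.hasFDerivAt hσd
    have h2 : HasDerivAt (fun s : ℝ ↦ Complex.exp (s * Complex.I))
        (Complex.exp (t * Complex.I) * (1 * Complex.I)) t :=
      ((Complex.ofRealCLM.hasDerivAt (x := t)).mul_const Complex.I).cexp
    have h3 : (P ∘ e.symm) ∘ σ =ᶠ[𝓝 t] fun s : ℝ ↦ Complex.exp (s * Complex.I) := by
      filter_upwards [hsrc, hcont.continuousAt.eventually hPc] with s hs hs'
      simp only [hσ, Function.comp_apply, e.left_inv hs]
      rw [hs' _ rfl, Circle.coe_exp]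
    have h4 := (h1.congr_of_eventuallyEq h3.symm).unique h2
    rw [h0, map_zero] at h4
    simp [Complex.exp_ne_zero] at h4
  have hSu : S = Submodule.span ℝ {u} := by
    refine le_antisymm (fun s hs ↦ ?_) ((Submodule.span_singleton_le_iff_mem _ _).2 huS)
    set x : ℝ → EuclideanSpace ℝ (Fin d) := fun τ ↦ a + τ • s with hx
    have hx0 : x 0 = a := by simp [hx]
    have hxd : HasDerivAt x s 0 := by
      simpa [hx] using (hasDerivAt_id (0 : ℝ)).smul_const s
    set θ₀ : ℂ := (Circle.exp t : ℂ) with hθ₀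
    -- The angle of a + τ s, measured from `t`. At τ = 0 the quotient is 1, where the principal
    -- logarithm is differentiable.
    set r : ℝ → ℝ := fun τ ↦ t + (Complex.log ((P ∘ e.symm) (x τ) / θ₀)).im with hr
    have hP0 : (P ∘ e.symm) (x 0) / θ₀ = 1 := by
      rw [hx0, Function.comp_apply, ha, e.left_inv hpe, hPc.self_of_nhds _ rfl, hθ₀]
      exact div_self (Circle.coe_ne_zero _)
    have hrd : DifferentiableAt ℝ r 0 := by
      have h1 : DifferentiableAt ℝ (fun τ ↦ (P ∘ e.symm) (x τ) / θ₀) 0 :=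
        (DifferentiableAt.comp (0 : ℝ) (by rwa [hx0]) hxd.differentiableAt).div_const _
      have h2 := h1.hasDerivAt.clog_real (by rw [hP0]; simp)
      exact (Complex.imCLM.differentiableAt.comp (0 : ℝ) h2.differentiableAt).const_add t
    have hr0 : r 0 = t := by simp only [hr, hP0]; simp
    have hxr : x =ᶠ[𝓝 0] σ ∘ r := by
      have hxt : Filter.Tendsto x (𝓝 0) (𝓝 a) := by
        simpa [ContinuousAt, hx0] using hxd.continuousAt
      have hxp := hsymm.comp hxt
      filter_upwards [hxt.eventually (e.open_target.mem_nhds (e.map_source hpe)),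
        hxp.eventually hPc, hxp.eventually
          (hF.eventually_mem_connectedComponentIn (hq ▸ Set.mem_range_self (Circle.exp t)))]
        with τ h1 h2 h3
      have h4 : e.symm (x τ) ∈ critSet d F := by
        rw [hS _ (e.map_target h1), e.right_inv h1]
        simpa [hx] using S.smul_mem τ hs
      have h5 := h3 h4
      rw [← hq] at h5
      obtain ⟨θ, hθ⟩ := h5
      have h6 : (P ∘ e.symm) (x τ) = θ := h2 θ hθ
      have h7 : Circle.exp (r τ) = θ := by
        have h8 : (P ∘ e.symm) (x τ) / θ₀ = ((θ / Circle.exp t : Circle) : ℂ) := by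
          rw [h6, hθ₀, Circle.coe_div]
        simp only [hr]
        rw [Circle.exp_add, h8, Complex.log_im, Circle.exp_arg, mul_div_cancel]
      simp only [hσ, Function.comp_apply, h7]
      rw [hθ]
      exact (e.right_inv h1).symm
    have h1 : HasDerivAt (σ ∘ r) (deriv r 0 • u) 0 :=
      HasDerivAt.scomp (0 : ℝ) (by rwa [hr0]) hrd.hasDerivAt
    rw [hxd.unique (h1.congr_of_eventuallyEq hxr)]
    exact Submodule.smul_mem _ _ (Submodule.mem_span_singleton_self u)
  -- The orthogonal coordinate along `u`; any linear form with value 1 at `u` would serve.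
  set l : EuclideanSpace ℝ (Fin d) →L[ℝ] ℝ := (‖u‖ ^ 2)⁻¹ • innerSL ℝ u with hl
  have hlu : l u = 1 := by
    have : ‖u‖ ≠ 0 := norm_ne_zero_iff.2 hu0
    simp [hl, this]
  have haff : Continuous fun x ↦ a + l (x - a) • u := by fun_prop
  have haffa : a + l (a - a) • u = a := by simp
  have hafft : Filter.Tendsto (fun x ↦ a + l (x - a) • u) (𝓝 a) (𝓝 a) := by
    simpa [ContinuousAt] using haff.continuousAt (x := a)
  have htgt : e.target ∈ 𝓝 a := e.open_target.mem_nhds (e.map_source hpe)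
  refine ⟨⟨e, he, hpe, u, l, hlu, hσd, hSu ▸ hS, fun v hv hvw ↦ ?_,
    fun y ↦ (P (e.symm (a + l (e y - a) • u))).re, ?_, ?_, ?_⟩⟩
  · have h1 := hN (LinearMap.ker (l : EuclideanSpace ℝ (Fin d) →ₗ[ℝ] ℝ))
      (hSu ▸ isCompl_span_singleton_ker (l := (l : EuclideanSpace ℝ (Fin d) →ₗ[ℝ] ℝ)) hlu)
    have h2 := h1.1 ⟨v, hv⟩ fun w ↦ hvw w w.2
    exact congrArg Subtype.val h2
  · have h1 : Filter.Tendsto (fun y ↦ a + l (e y - a) • u) (𝓝 p) (𝓝 a) :=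
      hafft.comp (e.continuousAt hpe)
    filter_upwards [e.open_source.mem_nhds hpe, h1.eventually htgt,
      (hsymm.comp h1).eventually hP] with y hy1 hy2 hy3
    have h2 : ContDiff ℝ ∞ fun x ↦ a + l (x - a) • u := by fun_prop
    have h3 : ContMDiffAt (𝓡 d) (𝓡 d) ∞ (fun y ↦ a + l (e y - a) • u) y :=
      h2.contMDiff.contMDiffAt.comp y (contMDiffAt_of_mem_maximalAtlas he hy1)
    have h4 : ContMDiffAt 𝓘(ℝ, ℂ) 𝓘(ℝ, ℝ) ∞ Complex.re (P (e.symm (a + l (e y - a) • u))) :=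
      Complex.reCLM.contDiff.contMDiff.contMDiffAt
    exact h4.comp y (hy3.comp y ((contMDiffAt_symm_of_mem_maximalAtlas he hy2).comp y h3))
  · filter_upwards [e.open_source.mem_nhds hpe, hPc] with y hy1 hy2 θ hθ
    have h1 : e y - a ∈ Submodule.span ℝ {u} := by
      rw [← hSu, ← hS y hy1, ← hθ]
      exact hcrit θ
    have h2 : l (e y - a) • u = e y - a :=
      (mem_span_singleton_iff_of_apply_eq_one
        (l := (l : EuclideanSpace ℝ (Fin d) →ₗ[ℝ] ℝ)) hlu _).1 h1
    rw [h2, add_sub_cancel, e.left_inv hy1, hy2 θ hθ]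
  · filter_upwards [htgt, hafft.eventually htgt] with x h1 h2
    rw [e.right_inv h1, e.right_inv h2]
    simp [hlu]

end CircleChart

/-! ### The function `F + ε h` read in a chart. -/

section Perturbation

variable {d : ℕ} {M : Type*} [TopologicalSpace M] [ChartedSpace (EuclideanSpace ℝ (Fin d)) M]
  {F h : M → ℝ} {p : M} {e : OpenPartialHomeomorph M (EuclideanSpace ℝ (Fin d))}

lemma fderiv_add_mul_comp_symm (he : e ∈ IsManifold.maximalAtlas (𝓡 d) ∞ M) (hp : p ∈ e.source)
    (hF : ContMDiffAt (𝓡 d) 𝓘(ℝ, ℝ) ∞ F p) (hh : ContMDiffAt (𝓡 d) 𝓘(ℝ, ℝ) ∞ h p) (ε : ℝ) :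
    fderiv ℝ ((fun y ↦ F y + ε * h y) ∘ e.symm) (e p) =
      fderiv ℝ (F ∘ e.symm) (e p) + ε • fderiv ℝ (h ∘ e.symm) (e p) := by
  have h1 : DifferentiableAt ℝ (F ∘ e.symm) (e p) :=
    (contDiffAt_comp_symm he hp hF).differentiableAt (by simp)
  have h2 : DifferentiableAt ℝ (h ∘ e.symm) (e p) :=
    (contDiffAt_comp_symm he hp hh).differentiableAt (by simp)
  exact (h1.hasFDerivAt.add (h2.hasFDerivAt.const_smul ε)).fderiv

lemma contMDiff_add_mul (hF : ContMDiff (𝓡 d) 𝓘(ℝ, ℝ) ∞ F) (hh : ContMDiff (𝓡 d) 𝓘(ℝ, ℝ) ∞ h)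
    (ε : ℝ) : ContMDiff (𝓡 d) 𝓘(ℝ, ℝ) ∞ fun y ↦ F y + ε * h y := by
  have h1 : ContDiff ℝ ∞ fun z : ℝ × ℝ ↦ z.1 + ε * z.2 := by fun_prop
  exact h1.contMDiff.comp (hF.prodMk_space hh)

lemma mem_critSet_add_mul_iff (he : e ∈ IsManifold.maximalAtlas (𝓡 d) ∞ M) (hp : p ∈ e.source)
    (hF : ContMDiff (𝓡 d) 𝓘(ℝ, ℝ) ∞ F) (hh : ContMDiff (𝓡 d) 𝓘(ℝ, ℝ) ∞ h) (ε : ℝ) :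
    p ∈ critSet d (fun y ↦ F y + ε * h y) ↔
      fderiv ℝ (F ∘ e.symm) (e p) + ε • fderiv ℝ (h ∘ e.symm) (e p) = 0 := by
  rw [mem_critSet_iff he hp (contMDiff_add_mul hF hh ε p),
    fderiv_add_mul_comp_symm he hp (hF p) (hh p)]

lemma hessianIn_add_mul (he : e ∈ IsManifold.maximalAtlas (𝓡 d) ∞ M) (hp : p ∈ e.source)
    (hF : ContMDiff (𝓡 d) 𝓘(ℝ, ℝ) ∞ F) (hh : ContMDiff (𝓡 d) 𝓘(ℝ, ℝ) ∞ h) (ε : ℝ)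
    (v w : EuclideanSpace ℝ (Fin d)) :
    hessianIn e (fun y ↦ F y + ε * h y) p v w = hessianIn e F p v w + ε * hessianIn e h p v w := by
  have hd : ∀ {f : M → ℝ}, ContMDiff (𝓡 d) 𝓘(ℝ, ℝ) ∞ f →
      DifferentiableAt ℝ (fderiv ℝ (f ∘ e.symm)) (e p) := fun {f} hf ↦
    ((contDiffAt_comp_symm he hp (hf p)).fderiv_right (m := 1) (by norm_cast)).differentiableAt
      (by simp)
  have heq : fderiv ℝ ((fun y ↦ F y + ε * h y) ∘ e.symm) =ᶠ[𝓝 (e p)]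
      fun x ↦ fderiv ℝ (F ∘ e.symm) x + ε • fderiv ℝ (h ∘ e.symm) x := by
    filter_upwards [e.open_target.mem_nhds (e.map_source hp)] with x hx
    have := fderiv_add_mul_comp_symm he (e.map_target hx) (hF _) (hh _) ε
    rwa [e.right_inv hx] at this
  rw [hessianIn_apply, heq.fderiv_eq]
  change fderiv ℝ (fderiv ℝ (F ∘ e.symm) + ε • fderiv ℝ (h ∘ e.symm)) (e p) v w = _
  rw [((hd hF).hasFDerivAt.add ((hd hh).hasFDerivAt.const_smul ε)).fderiv]
  rfl

/-- Near a regular point of `F`, small perturbations of `F` have no critical points. -/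
lemma eventually_notMem_critSet_add_mul [IsManifold (𝓡 d) ∞ M]
    (hF : ContMDiff (𝓡 d) 𝓘(ℝ, ℝ) ∞ F) (hh : ContMDiff (𝓡 d) 𝓘(ℝ, ℝ) ∞ h)
    (hp : p ∉ critSet d F) :
    ∀ᶠ z in 𝓝[>] (0 : ℝ) ×ˢ 𝓝 p, z.2 ∉ critSet d (fun y ↦ F y + z.1 * h y) := by
  set e := chartAt (EuclideanSpace ℝ (Fin d)) p
  have he : e ∈ IsManifold.maximalAtlas (𝓡 d) ∞ M := IsManifold.chart_mem_maximalAtlas p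
  have hpe : p ∈ e.source := mem_chart_source _ p
  have h1 := eventually_fderiv_add_smul_ne_zero
    ((contDiffAt_comp_symm he hpe (hF p)).of_le (by norm_cast))
    ((contDiffAt_comp_symm he hpe (hh p)).of_le (by norm_cast))
    fun h0 ↦ hp ((mem_critSet_iff he hpe (hF p)).2 h0)
  have h2 : Filter.Tendsto (Prod.map id e) (𝓝[>] (0 : ℝ) ×ˢ 𝓝 p) (𝓝[>] (0 : ℝ) ×ˢ 𝓝 (e p)) :=
    Filter.tendsto_id.prodMap (e.continuousAt hpe)
  filter_upwards [h2.eventually h1,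
    (Filter.Eventually.of_forall fun _ ↦ trivial : ∀ᶠ _ in 𝓝[>] (0 : ℝ), True).prod_mk
      (e.open_source.mem_nhds hpe)] with z hz hz'
  rw [mem_critSet_add_mul_iff he hz'.2 hF hh]
  exact hz

end Perturbation

/-! ### Perturbation near the circle. -/

namespace CircleChart

variable {d : ℕ} {M : Type*} [TopologicalSpace M] [ChartedSpace (EuclideanSpace ℝ (Fin d)) M]
  {F h : M → ℝ} {c : Circle → M} {t : ℝ}

/-- The projection along `coord = 0` to the line spanned by `dir`. -/
noncomputable def proj (Φ : CircleChart d F c t) :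
    EuclideanSpace ℝ (Fin d) →L[ℝ] EuclideanSpace ℝ (Fin d) :=
  Φ.coord.smulRight Φ.dir

lemma proj_apply (Φ : CircleChart d F c t) (x : EuclideanSpace ℝ (Fin d)) :
    Φ.proj x = Φ.coord x • Φ.dir := rfl

lemma proj_proj (Φ : CircleChart d F c t) (x : EuclideanSpace ℝ (Fin d)) :
    Φ.proj (Φ.proj x) = Φ.proj x := by
  simp [proj_apply, Φ.coord_dir]

lemma coord_eq_zero_of_proj_eq_zero (Φ : CircleChart d F c t) {x : EuclideanSpace ℝ (Fin d)}
    (hx : Φ.proj x = 0) : Φ.coord x = 0 := by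
  have := congrArg Φ.coord hx
  simpa [proj_apply, Φ.coord_dir] using this

lemma mem_critSet_iff_proj (Φ : CircleChart d F c t) {x : M} (hx : x ∈ Φ.chart.source) :
    x ∈ critSet d F ↔ Φ.chart x = Φ.chart (c (Circle.exp t)) +
      Φ.proj (Φ.chart x - Φ.chart (c (Circle.exp t))) := by
  rw [Φ.mem_critSet_iff_sub_mem x hx, mem_span_singleton_iff_of_apply_eq_one
    (l := (Φ.coord : EuclideanSpace ℝ (Fin d) →ₗ[ℝ] ℝ)) Φ.coord_dir, proj_apply,
    ← sub_eq_iff_eq_add', eq_comm]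
  rfl

lemma tendsto_symm (Φ : CircleChart d F c t) :
    Filter.Tendsto Φ.chart.symm (𝓝 (Φ.chart (c (Circle.exp t)))) (𝓝 (c (Circle.exp t))) := by
  simpa [ContinuousAt, Φ.chart.left_inv Φ.mem_source] using
    Φ.chart.symm.continuousAt (Φ.chart.map_source Φ.mem_source)

lemma tendsto_proj (Φ : CircleChart d F c t) (a : EuclideanSpace ℝ (Fin d)) :
    Filter.Tendsto (fun x ↦ a + Φ.proj (x - a)) (𝓝 a) (𝓝 a) := by
  have : ContinuousAt (fun x ↦ a + Φ.proj (x - a)) a := by fun_prop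
  simpa [ContinuousAt] using this

lemma chart_target_mem_nhds (Φ : CircleChart d F c t) :
    Φ.chart.target ∈ 𝓝 (Φ.chart (c (Circle.exp t))) :=
  Φ.chart.open_target.mem_nhds (Φ.chart.map_source Φ.mem_source)

lemma mem_critSet (Φ : CircleChart d F c t) : c (Circle.exp t) ∈ critSet d F := by
  simp [Φ.mem_critSet_iff_sub_mem _ Φ.mem_source]

lemma eventually_fderiv_eq_zero (Φ : CircleChart d F c t)
    (hF : ContMDiff (𝓡 d) 𝓘(ℝ, ℝ) ∞ F) :
    ∀ᶠ x in 𝓝 (Φ.chart (c (Circle.exp t))), fderiv ℝ (F ∘ Φ.chart.symm)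
      (Φ.chart (c (Circle.exp t)) + Φ.proj (x - Φ.chart (c (Circle.exp t)))) = 0 := by
  filter_upwards [(Φ.tendsto_proj _).eventually Φ.chart_target_mem_nhds] with x hx
  have h1 := Φ.chart.map_target hx
  have h2 := mem_critSet_iff Φ.mem_maximalAtlas h1 (hF _)
  rw [Φ.chart.right_inv hx] at h2
  rw [← h2, Φ.mem_critSet_iff_proj h1, Φ.chart.right_inv hx]
  simp [proj_proj]

/-- dF vanishes along the line of `dir`; differentiating this identity along the line gives the
claim. -/
lemma hessianIn_dir (Φ : CircleChart d F c t) (hF : ContMDiff (𝓡 d) 𝓘(ℝ, ℝ) ∞ F)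
    (w : EuclideanSpace ℝ (Fin d)) :
    hessianIn Φ.chart F (c (Circle.exp t)) Φ.dir w = 0 := by
  set a := Φ.chart (c (Circle.exp t)) with ha
  have h1 : HasFDerivAt (fderiv ℝ (F ∘ Φ.chart.symm)) (fderiv ℝ (fderiv ℝ (F ∘ Φ.chart.symm)) a)
      (a + Φ.proj (a - a)) := by
    have := ((contDiffAt_comp_symm Φ.mem_maximalAtlas Φ.mem_source (hF _)).fderiv_right (m := 1)
      (by norm_cast)).differentiableAt (by simp)
    simpa using this.hasFDerivAt
  have hτ : HasFDerivAt (fun x ↦ a + Φ.proj (x - a)) Φ.proj a := by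
    simpa using (Φ.proj.hasFDerivAt.comp a ((hasFDerivAt_id a).sub_const a)).const_add a
  have h2 := (h1.comp a hτ).unique
    ((hasFDerivAt_const (0 : EuclideanSpace ℝ (Fin d) →L[ℝ] ℝ) a).congr_of_eventuallyEq
      (Φ.eventually_fderiv_eq_zero hF))
  have h3 := DFunLike.congr_fun h2 Φ.dir
  have h4 : Φ.proj Φ.dir = Φ.dir := by simp [proj_apply, Φ.coord_dir]
  rw [ContinuousLinearMap.comp_apply, h4] at h3
  rw [hessianIn_apply, ← ha, h3]
  rfl

/-- Normal nondegeneracy makes the Hessian injective on the normal space, and an injective linear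
map on a finite-dimensional space is bounded below. -/
lemma exists_bound (Φ : CircleChart d F c t) :
    ∃ b : ℝ, 0 < b ∧ ∀ v, Φ.proj v = 0 → b * ‖v‖ ≤
      ‖fderiv ℝ (fderiv ℝ (F ∘ Φ.chart.symm)) (Φ.chart (c (Circle.exp t))) v‖ := by
  set A := fderiv ℝ (fderiv ℝ (F ∘ Φ.chart.symm)) (Φ.chart (c (Circle.exp t)))
  set N := LinearMap.ker (Φ.proj : EuclideanSpace ℝ (Fin d) →ₗ[ℝ] EuclideanSpace ℝ (Fin d))
  set T : N →L[ℝ] EuclideanSpace ℝ (Fin d) →L[ℝ] ℝ := A.comp N.subtypeL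
  have hT : LinearMap.ker (T : N →ₗ[ℝ] EuclideanSpace ℝ (Fin d) →L[ℝ] ℝ) = ⊥ := by
    rw [LinearMap.ker_eq_bot']
    intro v hv
    ext1
    refine Φ.nondegenerate v (Φ.coord_eq_zero_of_proj_eq_zero v.2) fun w _ ↦ ?_
    exact DFunLike.congr_fun hv w
  obtain ⟨K, hK, hKT⟩ := LinearMap.exists_antilipschitzWith _ hT
  refine ⟨(K : ℝ)⁻¹, by positivity, fun v hv ↦ ?_⟩
  have := ZeroHomClass.bound_of_antilipschitz _ hKT ⟨v, hv⟩
  rw [inv_mul_le_iff₀ (by positivity)]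
  exact this

lemma comp_symm_eventuallyEq_cos (Φ : CircleChart d F c t) (hcont : Continuous c)
    (hhc : ∀ θ, h (c θ) = (θ : ℂ).re) :
    (h ∘ Φ.chart.symm) ∘ (fun s ↦ Φ.chart (c (Circle.exp s))) =ᶠ[𝓝 t] Real.cos := by
  have h1 : Continuous fun s ↦ c (Circle.exp s) := hcont.comp Circle.exp.continuous
  filter_upwards [h1.continuousAt.eventually (Φ.chart.open_source.mem_nhds Φ.mem_source)] with s hs
  simp only [Function.comp_apply, Φ.chart.left_inv hs, hhc, Circle.coe_exp]
  simp

lemma fderiv_comp_symm_dir (Φ : CircleChart d F c t) (hcont : Continuous c)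
    (hh : ContMDiff (𝓡 d) 𝓘(ℝ, ℝ) ∞ h) (hhc : ∀ θ, h (c θ) = (θ : ℂ).re) :
    fderiv ℝ (h ∘ Φ.chart.symm) (Φ.chart (c (Circle.exp t))) Φ.dir = -Real.sin t := by
  have h1 : HasFDerivAt (h ∘ Φ.chart.symm)
      (fderiv ℝ (h ∘ Φ.chart.symm) (Φ.chart (c (Circle.exp t)))) (Φ.chart (c (Circle.exp t))) :=
    ((contDiffAt_comp_symm Φ.mem_maximalAtlas Φ.mem_source (hh _)).differentiableAt
      (by simp)).hasFDerivAt
  have h2 := h1.comp_hasDerivAt (f := fun s ↦ Φ.chart (c (Circle.exp s))) t Φ.hasDerivAt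
  exact h2.unique
    ((Real.hasDerivAt_cos t).congr_of_eventuallyEq (Φ.comp_symm_eventuallyEq_cos hcont hhc))

lemma comp_symm_proj (Φ : CircleChart d F c t) (hext : h =ᶠ[𝓝 (c (Circle.exp t))] Φ.ext) :
    ∀ᶠ x in 𝓝 (Φ.chart (c (Circle.exp t))), (h ∘ Φ.chart.symm) x = (h ∘ Φ.chart.symm)
      (Φ.chart (c (Circle.exp t)) + Φ.proj (x - Φ.chart (c (Circle.exp t)))) := by
  filter_upwards [Φ.ext_proj, Φ.tendsto_symm.eventually hext,
    (Φ.tendsto_symm.comp (Φ.tendsto_proj _)).eventually hext] with x h1 h2 h3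
  rw [Function.comp_apply, h2, h1, Function.comp_apply]
  exact h3.symm

/-- Supplies the constants `b` and `C` of the abstract estimate. The hypothesis on `ext` is needed
only where the tangential derivative -sin t vanishes. -/
lemma eventually_mem_critSet (Φ : CircleChart d F c t) (hcont : Continuous c)
    (hh : ContMDiff (𝓡 d) 𝓘(ℝ, ℝ) ∞ h) (hhc : ∀ θ, h (c θ) = (θ : ℂ).re)
    (hF : ContMDiff (𝓡 d) 𝓘(ℝ, ℝ) ∞ F)
    (hext : Real.sin t = 0 → h =ᶠ[𝓝 (c (Circle.exp t))] Φ.ext) :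
    ∀ᶠ z in 𝓝[>] (0 : ℝ) ×ˢ 𝓝 (c (Circle.exp t)),
      z.2 ∈ critSet d (fun y ↦ F y + z.1 * h y) → z.2 ∈ critSet d F ∧ z.2 ∈ critSet d h := by
  have he := Φ.mem_maximalAtlas
  have hF2 : ContDiffAt ℝ 2 (F ∘ Φ.chart.symm) (Φ.chart (c (Circle.exp t))) :=
    (contDiffAt_comp_symm he Φ.mem_source (hF _)).of_le (by norm_cast)
  have hh2 : ContDiffAt ℝ 2 (h ∘ Φ.chart.symm) (Φ.chart (c (Circle.exp t))) :=
    (contDiffAt_comp_symm he Φ.mem_source (hh _)).of_le (by norm_cast)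
  obtain ⟨b, hb, hbA⟩ := Φ.exists_bound
  obtain ⟨C, hC, hCh⟩ : ∃ C : ℝ, 0 ≤ C ∧ ∀ᶠ x in 𝓝 (Φ.chart (c (Circle.exp t))),
      ‖fderiv ℝ (h ∘ Φ.chart.symm) (Φ.chart (c (Circle.exp t)) +
        Φ.proj (x - Φ.chart (c (Circle.exp t))))‖ ≤
      C * ‖(fderiv ℝ (h ∘ Φ.chart.symm) (Φ.chart (c (Circle.exp t)) +
        Φ.proj (x - Φ.chart (c (Circle.exp t))))).comp Φ.proj‖ := by
    by_cases ht : Real.sin t = 0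
    · refine ⟨1, zero_le_one, ?_⟩
      filter_upwards [eventually_fderiv_comp_eq hh2 Φ.proj_proj (Φ.comp_symm_proj (hext ht))]
        with x hx
      rw [hx, one_mul]
    · set a := Φ.chart (c (Circle.exp t)) with ha
      have hpos : 0 < ‖(fderiv ℝ (h ∘ Φ.chart.symm) a).comp Φ.proj‖ := by
        rw [norm_pos_iff]
        intro h0
        have h1 := DFunLike.congr_fun h0 Φ.dir
        have h4 : Φ.proj Φ.dir = Φ.dir := by simp [proj_apply, Φ.coord_dir]
        rw [ContinuousLinearMap.comp_apply, h4, Φ.fderiv_comp_symm_dir hcont hh hhc] at h1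
        exact ht (by simpa using h1)
      set m := ‖(fderiv ℝ (h ∘ Φ.chart.symm) a).comp Φ.proj‖ with hm
      set k := ‖fderiv ℝ (h ∘ Φ.chart.symm) a‖ with hk
      have hk0 : 0 ≤ k := norm_nonneg _
      have hcd : ContinuousAt (fderiv ℝ (h ∘ Φ.chart.symm)) a :=
        (hh2.fderiv_right (m := 1) (by norm_num)).continuousAt
      have hcd' : ContinuousAt
          (fun x ↦ (fderiv ℝ (h ∘ Φ.chart.symm) x).comp Φ.proj) a :=
        hcd.clm_comp continuousAt_const
      -- By continuity the norm of dh stays below `k + 1`, and that of its tangential part above `m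
      -- / 2`.
      refine ⟨(k + 1) / (m / 2), by positivity, ?_⟩
      filter_upwards [(Φ.tendsto_proj a).eventually (hcd.norm.eventually_lt_const
        (show k < k + 1 by linarith)), (Φ.tendsto_proj a).eventually
        (hcd'.norm.eventually_const_lt (show m / 2 < m by linarith))] with x h1 h2
      rw [div_mul_eq_mul_div, le_div_iff₀ (by positivity)]
      exact mul_le_mul h1.le h2.le (by positivity) (by positivity)
  have key := eventually_eq_of_fderiv_add_smul_eq_zero hF2 hh2 Φ.proj_proj
    (Φ.eventually_fderiv_eq_zero hF) hb hbA hC hCh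
  have h2 : Filter.Tendsto (Prod.map id Φ.chart) (𝓝[>] (0 : ℝ) ×ˢ 𝓝 (c (Circle.exp t)))
      (𝓝[>] (0 : ℝ) ×ˢ 𝓝 (Φ.chart (c (Circle.exp t)))) :=
    Filter.tendsto_id.prodMap (Φ.chart.continuousAt Φ.mem_source)
  have hpos : ∀ᶠ ε in 𝓝[>] (0 : ℝ), 0 < ε := self_mem_nhdsWithin
  filter_upwards [h2.eventually key,
    hpos.prod_mk (Φ.chart.open_source.mem_nhds Φ.mem_source)] with z hz hz' hcrit
  rw [mem_critSet_add_mul_iff he hz'.2 hF hh] at hcrit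
  have h3 := (Φ.mem_critSet_iff_proj hz'.2).2 (hz hcrit)
  refine ⟨h3, (mem_critSet_iff he hz'.2 (hh _)).2 ?_⟩
  -- At a critical point of `F` only ε dh is left, and ε > 0.
  rw [(mem_critSet_iff he hz'.2 (hF _)).1 h3, zero_add] at hcrit
  exact (smul_eq_zero.1 hcrit).resolve_left hz'.1.ne'

lemma sin_eq_zero_of_mem_critSet (Φ : CircleChart d F c t) (hcont : Continuous c)
    (hh : ContMDiff (𝓡 d) 𝓘(ℝ, ℝ) ∞ h) (hhc : ∀ θ, h (c θ) = (θ : ℂ).re)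
    (hcrit : c (Circle.exp t) ∈ critSet d h) : Real.sin t = 0 := by
  have h1 := Φ.fderiv_comp_symm_dir hcont hh hhc
  rw [(mem_critSet_iff Φ.mem_maximalAtlas Φ.mem_source (hh _)).1 hcrit] at h1
  simpa using h1.symm

/-- The tangential derivative is -sin t = 0, and the normal ones vanish because `h` is constant
along the slices near the point. -/
lemma mem_critSet_of_sin_eq_zero (Φ : CircleChart d F c t) (hcont : Continuous c)
    (hh : ContMDiff (𝓡 d) 𝓘(ℝ, ℝ) ∞ h) (hhc : ∀ θ, h (c θ) = (θ : ℂ).re)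
    (ht : Real.sin t = 0)
    (hext : h =ᶠ[𝓝 (c (Circle.exp t))] Φ.ext) : c (Circle.exp t) ∈ critSet d h := by
  rw [mem_critSet_iff Φ.mem_maximalAtlas Φ.mem_source (hh _)]
  have h1 := (eventually_fderiv_comp_eq
    ((contDiffAt_comp_symm Φ.mem_maximalAtlas Φ.mem_source (hh _)).of_le (by norm_cast))
    Φ.proj_proj (Φ.comp_symm_proj hext)).self_of_nhds
  simp only [sub_self, map_zero, add_zero] at h1
  rw [← h1]
  ext v
  simp [proj_apply, Φ.fderiv_comp_symm_dir hcont hh hhc, ht]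

/-- Near the point `h` depends on `coord` alone, so its Hessian is a multiple of the square of
`coord`. The factor is read off along the circle, where `h` is cos; as the point is critical for
`h`, the curvature of the circle in the chart does not enter. -/
lemma hessianIn_eq [IsManifold (𝓡 d) ∞ M] (Φ : CircleChart d F c t)
    (hc : Manifold.IsSmoothEmbedding (𝓡 1) (𝓡 d) ∞ c)
    (hh : ContMDiff (𝓡 d) 𝓘(ℝ, ℝ) ∞ h) (hhc : ∀ θ, h (c θ) = (θ : ℂ).re)
    (ht : Real.sin t = 0) (hext : h =ᶠ[𝓝 (c (Circle.exp t))] Φ.ext)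
    (v w : EuclideanSpace ℝ (Fin d)) : hessianIn Φ.chart h (c (Circle.exp t)) v w =
      -Real.cos t * (Φ.coord v * Φ.coord w) := by
  have hσ : ContDiffAt ℝ 2 (fun s ↦ Φ.chart (c (Circle.exp s))) t :=
    (contDiffAt_chart_circle hc Φ.mem_maximalAtlas Φ.mem_source).of_le (by norm_cast)
  have hcont : Continuous c := hc.isEmbedding.continuous
  have hcrit := (mem_critSet_iff Φ.mem_maximalAtlas Φ.mem_source (hh _)).1
    (Φ.mem_critSet_of_sin_eq_zero hcont hh hhc ht hext)
  have hh2 : ContDiffAt ℝ 2 (h ∘ Φ.chart.symm) (Φ.chart (c (Circle.exp t))) :=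
    (contDiffAt_comp_symm Φ.mem_maximalAtlas Φ.mem_source (hh _)).of_le (by norm_cast)
  set a := Φ.chart (c (Circle.exp t)) with ha
  have h1 := fderiv_fderiv_comp_of_fderiv_eq_zero (τ := fun s ↦ Φ.chart (c (Circle.exp s)))
    hh2 hσ hcrit 1 1
  rw [((Φ.comp_symm_eventuallyEq_cos hcont hhc).fderiv (𝕜 := ℝ)).fderiv_eq,
    Φ.hasDerivAt.hasFDerivAt.fderiv] at h1
  have h2 : fderiv ℝ (fderiv ℝ Real.cos) t 1 1 = -Real.cos t := by
    have h3 : fderiv ℝ Real.cos = fun x ↦ -Real.sin x • ContinuousLinearMap.id ℝ ℝ := by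
      ext x
      simp
    have h4 : HasFDerivAt (fun x : ℝ ↦ -Real.sin x • ContinuousLinearMap.id ℝ ℝ) _ t :=
      ((Real.hasDerivAt_sin t).neg.smul_const (ContinuousLinearMap.id ℝ ℝ)).hasFDerivAt
    rw [h3, h4.fderiv]
    simp
  have hτa : a + Φ.proj (a - a) = a := by simp
  have hτ : HasFDerivAt (fun x ↦ a + Φ.proj (x - a)) Φ.proj a := by
    simpa using (Φ.proj.hasFDerivAt.comp a ((hasFDerivAt_id a).sub_const a)).const_add a
  have h5 := fderiv_fderiv_comp_of_fderiv_eq_zero (f := h ∘ Φ.chart.symm)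
    (τ := fun x ↦ a + Φ.proj (x - a)) (a := a) (by rwa [hτa]) (by fun_prop) (by rwa [hτa]) v w
  have h6 : h ∘ Φ.chart.symm =ᶠ[𝓝 a] (h ∘ Φ.chart.symm) ∘ fun x ↦ a + Φ.proj (x - a) :=
    Φ.comp_symm_proj hext
  rw [← (h6.fderiv (𝕜 := ℝ)).fderiv_eq, hτa, hτ.fderiv] at h5
  rw [hessianIn_apply, ← ha, h5]
  simp only [ContinuousLinearMap.toSpanSingleton_apply, one_smul] at h1
  simp only [proj_apply, map_smul, smul_apply, smul_eq_mul]
  rw [← ha] at h1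
  rw [← h1, h2]
  ring

end CircleChart

/-! ### Nondegeneracy and index at the two surviving points. -/

section Nondegenerate

variable {d : ℕ} {M : Type*} [TopologicalSpace M] [ChartedSpace (EuclideanSpace ℝ (Fin d)) M]
  {F h : M → ℝ} {c : Circle → M} {t ε : ℝ}

namespace CircleChart

lemma mem_critSet_add_mul (Φ : CircleChart d F c t) (hF : ContMDiff (𝓡 d) 𝓘(ℝ, ℝ) ∞ F)
    (hcont : Continuous c) (hh : ContMDiff (𝓡 d) 𝓘(ℝ, ℝ) ∞ h) (hhc : ∀ θ, h (c θ) = (θ : ℂ).re)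
    (ht : Real.sin t = 0) (hext : h =ᶠ[𝓝 (c (Circle.exp t))] Φ.ext) :
    c (Circle.exp t) ∈ critSet d (fun y ↦ F y + ε * h y) := by
  rw [mem_critSet_add_mul_iff Φ.mem_maximalAtlas Φ.mem_source hF hh,
    (mem_critSet_iff Φ.mem_maximalAtlas Φ.mem_source (hF _)).1 Φ.mem_critSet,
    (mem_critSet_iff Φ.mem_maximalAtlas Φ.mem_source (hh _)).1
      (Φ.mem_critSet_of_sin_eq_zero hcont hh hhc ht hext), smul_zero, add_zero]

variable [IsManifold (𝓡 d) ∞ M]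

lemma hessianIn_add_mul_eq (Φ : CircleChart d F c t) (hF : ContMDiff (𝓡 d) 𝓘(ℝ, ℝ) ∞ F)
    (hc : Manifold.IsSmoothEmbedding (𝓡 1) (𝓡 d) ∞ c)
    (hh : ContMDiff (𝓡 d) 𝓘(ℝ, ℝ) ∞ h) (hhc : ∀ θ, h (c θ) = (θ : ℂ).re)
    (ht : Real.sin t = 0) (hext : h =ᶠ[𝓝 (c (Circle.exp t))] Φ.ext)
    (v w : EuclideanSpace ℝ (Fin d)) :
    hessianIn Φ.chart (fun y ↦ F y + ε * h y) (c (Circle.exp t)) v w =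
      hessianIn Φ.chart F (c (Circle.exp t)) v w +
        (-(ε * Real.cos t)) * (Φ.coord v * Φ.coord w) := by
  rw [hessianIn_add_mul Φ.mem_maximalAtlas Φ.mem_source hF hh,
    Φ.hessianIn_eq hc hh hhc ht hext]
  ring

lemma isNondegenerateCriticalPoint_add_mul (Φ : CircleChart d F c t)
    (hF : ContMDiff (𝓡 d) 𝓘(ℝ, ℝ) ∞ F) (hc : Manifold.IsSmoothEmbedding (𝓡 1) (𝓡 d) ∞ c)
    (hh : ContMDiff (𝓡 d) 𝓘(ℝ, ℝ) ∞ h) (hhc : ∀ θ, h (c θ) = (θ : ℂ).re)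
    (ht : Real.sin t = 0) (hext : h =ᶠ[𝓝 (c (Circle.exp t))] Φ.ext) (hε : 0 < ε) :
    IsNondegenerateCriticalPoint d (fun y ↦ F y + ε * h y) (c (Circle.exp t))
      (if 0 < Real.cos t then index d F (c (Circle.exp t)) + 1
        else index d F (c (Circle.exp t))) := by
  have he := Φ.mem_maximalAtlas
  have hG := contMDiff_add_mul hF hh ε
  have hcrit := Φ.mem_critSet_add_mul (ε := ε) hF hc.isEmbedding.continuous hh hhc ht hext
  have hcos : Real.cos t ≠ 0 := fun h0 ↦ by
    have := Real.sin_sq_add_cos_sq t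
    simp [ht, h0] at this
  have hB := Φ.hessianIn_add_mul_eq (ε := ε) hF hc hh hhc ht hext
  have hsymm := hessianIn_symm he Φ.mem_source (hG _)
  have hdir := Φ.hessianIn_dir hF
  have hdir' (w) : hessianIn Φ.chart F (c (Circle.exp t)) w Φ.dir = 0 := by
    rw [hessianIn_symm he Φ.mem_source (hF _), hdir]
  have hsep : ∀ v, (∀ w, hessianIn Φ.chart (fun y ↦ F y + ε * h y) (c (Circle.exp t)) v w = 0) →
      v = 0 := by
    intro v hv
    -- Pairing with `dir` sees only the added square, so `coord v = 0`; then the normal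
    -- nondegeneracy of `F` applies.
    have h1 := hv Φ.dir
    rw [hB, hdir', Φ.coord_dir] at h1
    have h2 : Φ.coord v = 0 := by simpa [hε.ne', hcos] using h1
    refine Φ.nondegenerate v h2 fun w hw ↦ ?_
    have h3 := hv w
    rw [hB, h2] at h3
    simpa using h3
  refine ⟨hcrit, hessian_nondegenerate_of_mem_maximalAtlas he Φ.mem_source (hG _) hcrit
    ⟨hsep, fun v hv ↦ hsep v fun w ↦ ?_⟩, ?_⟩
  · rw [hsymm]
    exact hv w
  · rw [index_eq_of_mem_maximalAtlas he Φ.mem_source (hG _) hcrit,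
      index_eq_of_mem_maximalAtlas he Φ.mem_source (hF _) Φ.mem_critSet]
    have hQ (x : EuclideanSpace ℝ (Fin d)) :
        LinearMap.BilinMap.toQuadraticMap (hessianIn Φ.chart F (c (Circle.exp t)))
          (x - (Φ.coord : EuclideanSpace ℝ (Fin d) →ₗ[ℝ] ℝ) x • Φ.dir) =
        LinearMap.BilinMap.toQuadraticMap (hessianIn Φ.chart F (c (Circle.exp t))) x := by
      simp [hdir, hdir']
    have hQ' (x : EuclideanSpace ℝ (Fin d)) :
        LinearMap.BilinMap.toQuadraticMap
          (hessianIn Φ.chart (fun y ↦ F y + ε * h y) (c (Circle.exp t))) x =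
        LinearMap.BilinMap.toQuadraticMap (hessianIn Φ.chart F (c (Circle.exp t))) x +
          (-(ε * Real.cos t)) * (Φ.coord : EuclideanSpace ℝ (Fin d) →ₗ[ℝ] ℝ) x ^ 2 := by
      simp [hB, sq]
    split_ifs with h0
    · exact sigNeg_add_sq_of_neg Φ.coord_dir hQ hQ' (neg_lt_zero.2 (mul_pos hε h0))
    · exact sigNeg_add_sq_of_nonneg Φ.coord_dir hQ hQ'
        (neg_nonneg.2 (mul_nonpos_of_nonneg_of_nonpos hε.le (not_lt.1 h0)))

end CircleChart

end Nondegenerate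

/-! ### Patching local extensions with prescribed germs. -/

section Extension

variable {d : ℕ} {M : Type*} [TopologicalSpace M] [T2Space M]
    [SecondCountableTopology M] [ChartedSpace (EuclideanSpace ℝ (Fin d)) M]
    [IsManifold (𝓡 d) ∞ M]

/-- Local smooth extensions of a function on a closed set `K` can be patched to a global one, which
vanishes outside a given neighborhood of `K` and agrees with the given local extensions near
finitely many points of `K`. -/
lemma exists_contMDiff_extension {K V : Set M} (hK : IsClosed K) (hV : IsOpen V) (hKV : K ⊆ V)
    {φ : M → ℝ} {g : M → M → ℝ}
    (hg : ∀ p ∈ K, ∀ᶠ y in 𝓝 p, ContMDiffAt (𝓡 d) 𝓘(ℝ, ℝ) ∞ (g p) y)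
    (hgφ : ∀ p ∈ K, ∀ᶠ y in 𝓝 p, y ∈ K → g p y = φ y) {B : Set M} (hB : B.Finite) (hBK : B ⊆ K) :
    ∃ h : M → ℝ, ContMDiff (𝓡 d) 𝓘(ℝ, ℝ) ∞ h ∧ (∀ y ∈ K, h y = φ y) ∧ (∀ y ∉ V, h y = 0) ∧
      ∀ b ∈ B, h =ᶠ[𝓝 b] g b := by
  have : LocallyCompactSpace M := Manifold.locallyCompact_of_finiteDimensional (𝓡 d)
  -- Disjoint neighborhoods keep the germs prescribed at different points of `B` from conflicting.
  obtain ⟨U, hU, hUd⟩ := hB.t2_separation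
  let O (b : M) : Set M := interior
    {y | (ContMDiffAt (𝓡 d) 𝓘(ℝ, ℝ) ∞ (g b) y ∧ (y ∈ K → g b y = φ y)) ∧ y ∈ V ∧ y ∈ U b}
  have hO (b : M) (hb : b ∈ K) : O b ∈ 𝓝 b :=
    interior_mem_nhds.2 (((hg b hb).and (hgφ b hb)).and
      ((hV.eventually_mem (hKV hb)).and ((hU b).2.eventually_mem (hU b).1)))
  have hA : ∀ b, ∃ A : Set M, IsClosed A ∧ (b ∈ K → A ∈ 𝓝 b) ∧ A ⊆ O b := by
    intro b
    by_cases hb : b ∈ K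
    · obtain ⟨A, hA, hAc, hAO⟩ := exists_mem_nhds_isClosed_subset (hO b hb)
      exact ⟨A, hAc, fun _ ↦ hA, hAO⟩
    · exact ⟨∅, isClosed_empty, fun h ↦ absurd h hb, Set.empty_subset _⟩
  choose A hAc hA hAO using hA
  -- All requirements on the value at `y` are equalities, so they define a convex set and a
  -- partition of unity preserves them. The germ at `b` is imposed on the closed set `A b`, so it is
  -- absent on an open set around any point outside all of these.
  let s (y : M) : Set ℝ :=
    {v | (y ∈ K → v = φ y) ∧ (y ∉ V → v = 0) ∧ ∀ b ∈ B, y ∈ A b → v = g b y}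
  have hs (y : M) : Convex ℝ (s y) := by
    have hmix {v w u α β : ℝ} (hv : v = u) (hw : w = u) (hab : α + β = 1) :
        α • v + β • w = u := by
      rw [hv, hw, ← add_smul, hab, one_smul]
    intro v hv w hw α β _ _ hab
    exact ⟨fun hy ↦ hmix (hv.1 hy) (hw.1 hy) hab, fun hy ↦ hmix (hv.2.1 hy) (hw.2.1 hy) hab,
      fun b hb hy ↦ hmix (hv.2.2 b hb hy) (hw.2.2 b hb hy) hab⟩
  obtain ⟨h, hh⟩ := exists_contMDiffMap_forall_mem_convex_of_local (n := ⊤) (𝓡 d) hs fun x ↦ by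
    by_cases hx : ∃ b ∈ B, x ∈ A b
    · obtain ⟨b, hb, hxb⟩ := hx
      refine ⟨O b, isOpen_interior.mem_nhds (hAO b hxb), g b,
        fun y hy ↦ (interior_subset hy).1.1.contMDiffWithinAt, fun y hy ↦ ?_⟩
      have hy' := interior_subset hy
      refine ⟨hy'.1.2, fun h ↦ absurd hy'.2.1 h, fun b' hb' hyb' ↦ ?_⟩
      have hyb'' := (interior_subset (hAO b' hyb')).2.2
      by_cases hbb : b' = b
      · rw [hbb]
      · exact absurd hy'.2.2 (Set.disjoint_left.1 (hUd hb' hb hbb) hyb'')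
    · have hxA : (⋃ b ∈ B, A b)ᶜ ∈ 𝓝 x :=
        (hB.isClosed_biUnion fun b _ ↦ hAc b).isOpen_compl.mem_nhds (by simpa using hx)
      by_cases hxK : x ∈ K
      · refine ⟨O x ∩ (⋃ b ∈ B, A b)ᶜ, Filter.inter_mem (hO x hxK) hxA, g x,
          fun y hy ↦ (interior_subset hy.1).1.1.contMDiffWithinAt, fun y hy ↦ ?_⟩
        have hy' := interior_subset hy.1
        exact ⟨hy'.1.2, fun h ↦ absurd hy'.2.1 h,
          fun b hb hyb ↦ absurd (Set.mem_biUnion hb hyb) hy.2⟩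
      · exact ⟨Kᶜ ∩ (⋃ b ∈ B, A b)ᶜ, Filter.inter_mem (hK.isOpen_compl.mem_nhds hxK) hxA, 0,
          contMDiffOn_const, fun y hy ↦ ⟨fun h ↦ absurd h hy.1, fun _ ↦ rfl,
            fun b hb hyb ↦ absurd (Set.mem_biUnion hb hyb) hy.2⟩⟩
  exact ⟨h, h.contMDiff, fun y hy ↦ (hh y).1 hy, fun y hy ↦ (hh y).2.1 hy, fun b hb ↦
    Filter.mem_of_superset (hA b (hBK hb)) fun y hy ↦ (hh y).2.2 b hb hy⟩

end Extension

end Bott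

/-! ### The proposition. -/

open Bott in
theorem proposition2p2 {d : ℕ} {M : Type*} [TopologicalSpace M] [T2Space M]
    [SecondCountableTopology M] [ChartedSpace (EuclideanSpace ℝ (Fin d)) M]
    [IsManifold (𝓡 d) ∞ M] (F : M → ℝ) (hF : Bott.IsBott d F) (γ : Set M)
    (hγ : Bott.IsCriticalCircle d F γ) (n : ℕ) (hn : Bott.CircleHasIndex d F γ n) :
    -- sufficiently small neighborhoods of `γ` contain no critical points outside `γ`
    (∃ U₀ ∈ 𝓝ˢ γ, U₀ ∩ Bott.critSet d F = γ) ∧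
    ∀ U ∈ 𝓝ˢ γ, U ∩ Bott.critSet d F = γ →
      ∃ G : M → ℝ, Bott.IsBott d G ∧ (∀ x, x ∉ U → G x = F x) ∧
        ∃ w ∈ γ, ∃ z ∈ γ, Bott.IsNondegenerateCriticalPoint d G w n ∧
          Bott.IsNondegenerateCriticalPoint d G z (n + 1) ∧
          U ∩ Bott.critSet d G = {w, z} := by
  refine ⟨?_, fun U hU hUγ ↦ ?_⟩
  · obtain ⟨⟨q, -, hq⟩, -⟩ := hγ
    exact hF.exists_mem_nhdsSet_inter_critSet hq
  have : LocallyCompactSpace M := Manifold.locallyCompact_of_finiteDimensional (𝓡 d)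
  obtain ⟨c, hc, rfl⟩ := hγ.2
  have hcont := hc.isEmbedding.continuous
  have hγK : IsCompact (Set.range c) := isCompact_range hcont
  have hchart (p : M) (hp : p ∈ Set.range c) : ∃ t, c (Circle.exp t) = p := by
    obtain ⟨θ, rfl⟩ := hp
    exact ⟨Complex.arg θ, by rw [Circle.exp_arg]⟩
  choose! s hs using hchart
  have hΦ (t : ℝ) : Nonempty (CircleChart d F c t) := hF.nonempty_circleChart hγ hc t
  let Φ (t : ℝ) : CircleChart d F c t := (hΦ t).some
  have hexp {t t' : ℝ} (h : c (Circle.exp t) = c (Circle.exp t')) :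
      Real.cos t = Real.cos t' ∧ Real.sin t = Real.sin t' := by
    have h1 : (Circle.exp t : ℂ) = Circle.exp t' := by rw [hc.isEmbedding.injective h]
    rw [Circle.coe_exp, Circle.coe_exp] at h1
    exact ⟨by simpa using congrArg Complex.re h1, by simpa using congrArg Complex.im h1⟩
  -- `K` confines the perturbation, and its compactness yields a uniform `ε`.
  obtain ⟨K, hK, hγV, hKU⟩ := exists_compact_between hγK isOpen_interior
    (subset_interior_iff_mem_nhdsSet.2 hU)
  -- The minimum of cos on the circle keeps the index; the maximum, at angle 0, raises it.
  set w := c (Circle.exp Real.pi) with hw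
  set z := c (Circle.exp 0) with hz
  have hwγ : w ∈ Set.range c := Set.mem_range_self _
  have hzγ : z ∈ Set.range c := Set.mem_range_self _
  have hwz : w ≠ z := fun h ↦ by
    have := (hexp h).1
    norm_num at this
  obtain ⟨h, hh, hhγ, hhV, hhB⟩ := exists_contMDiff_extension (d := d)
    (φ := fun y ↦ Real.cos (s y)) (g := fun p ↦ (Φ (s p)).ext) (B := {w, z})
    hγK.isClosed isOpen_interior hγV
    (fun p hp ↦ by simpa only [hs p hp] using (Φ (s p)).contMDiffAt_ext)
    (fun p hp ↦ by
      have h1 := (Φ (s p)).ext_eq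
      rw [hs p hp] at h1
      filter_upwards [h1] with y hy hyγ
      rw [hy _ (hs y hyγ), Circle.coe_exp, Complex.exp_ofReal_mul_I_re])
    (Set.toFinite _) (by
      rintro _ (rfl | rfl)
      exacts [hwγ, hzγ])
  have hhc (θ : Circle) : h (c θ) = (θ : ℂ).re := by
    have h1 := hs (c θ) (Set.mem_range_self θ)
    have h2 := hc.isEmbedding.injective h1
    rw [hhγ _ (Set.mem_range_self θ)]
    nth_rewrite 2 [← h2]
    rw [Circle.coe_exp, Complex.exp_ofReal_mul_I_re]
  have hmemB {p : M} (hp : p ∈ Set.range c) (h0 : Real.sin (s p) = 0) : p ∈ ({w, z} : Set M) := by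
    have h1 : Real.cos (s p) ^ 2 = 1 := by
      have := Real.sin_sq_add_cos_sq (s p)
      rw [h0] at this
      linarith
    have h2 : ∀ t, Real.sin t = 0 → Real.cos (s p) = Real.cos t → p = c (Circle.exp t) := by
      intro t ht hst
      rw [← hs p hp]
      congr 1
      ext
      rw [Circle.coe_exp, Circle.coe_exp]
      apply Complex.ext
      · simpa using hst
      · simp [h0, ht]
    rcases (by simpa using h1 : Real.cos (s p) = 1 ∨ Real.cos (s p) = -1) with h3 | h3
    · exact Or.inr (h2 0 (by simp) (by simpa using h3))
    · exact Or.inl (h2 Real.pi (by simp) (by simpa using h3))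
  have hloc : ∀ p ∈ K, ∀ᶠ y in 𝓝[>] (0 : ℝ) ×ˢ 𝓝 p,
      y.2 ∈ critSet d (fun x ↦ F x + y.1 * h x) → y.2 ∈ critSet d F ∧ y.2 ∈ critSet d h := by
    intro p hp
    by_cases hpc : p ∈ critSet d F
    · have hpγ : p ∈ Set.range c := hUγ ▸ ⟨interior_subset (hKU hp), hpc⟩
      have h1 := (Φ (s p)).eventually_mem_critSet hcont hh hhc hF.1 fun h0 ↦ by
        rw [hs p hpγ]
        exact hhB p (hmemB hpγ h0)
      rwa [hs p hpγ] at h1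
    · filter_upwards [eventually_notMem_critSet_add_mul hF.1 hh hpc] with y hy hy'
      exact absurd hy' hy
  obtain ⟨ε, hε, hεK⟩ : ∃ ε : ℝ, 0 < ε ∧ ∀ y ∈ K,
      y ∈ critSet d (fun x ↦ F x + ε * h x) → y ∈ critSet d F ∧ y ∈ critSet d h := by
    -- Compactness turns the pointwise neighborhoods into a product of a set of small `ε` with a
    -- neighborhood of `K`.
    obtain ⟨T, hT, W, hW, hTW⟩ := Filter.mem_prod_iff.1 (hK.mem_prod_nhdsSet_of_forall hloc)
    obtain ⟨ε, hεT, hε⟩ := Filter.nonempty_of_mem (Filter.inter_mem hT self_mem_nhdsWithin)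
    exact ⟨ε, hε, fun y hy ↦ hTW (Set.mk_mem_prod hεT (subset_of_mem_nhdsSet hW hy))⟩
  have hnd {p : M} (hp : p ∈ ({w, z} : Set M)) (hpγ : p ∈ Set.range c) (h0 : Real.sin (s p) = 0) :
      IsNondegenerateCriticalPoint d (fun x ↦ F x + ε * h x) p
        (if 0 < Real.cos (s p) then n + 1 else n) := by
    have h1 := (Φ (s p)).isNondegenerateCriticalPoint_add_mul hF.1 hc hh hhc h0
      (by rw [hs p hpγ]; exact hhB p hp) hε
    rwa [hs p hpγ, hn p hpγ] at h1
  have hsw := hexp (hs w hwγ)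
  have hsz := hexp (hs z hzγ)
  have hndw : IsNondegenerateCriticalPoint d (fun x ↦ F x + ε * h x) w n := by
    have := hnd (Or.inl rfl) hwγ (by simpa using hsw.2)
    rwa [hsw.1, Real.cos_pi, if_neg (by norm_num)] at this
  have hndz : IsNondegenerateCriticalPoint d (fun x ↦ F x + ε * h x) z (n + 1) := by
    have := hnd (Or.inr rfl) hzγ (by simpa using hsz.2)
    rwa [hsz.1, Real.cos_zero, if_pos (by norm_num)] at this
  have houtside {y : M} (hy : y ∉ K) : F =ᶠ[𝓝 y] fun x ↦ F x + ε * h x := by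
    filter_upwards [hK.isClosed.isOpen_compl.mem_nhds hy] with x hx
    rw [hhV x fun h ↦ hx (interior_subset h), mul_zero, add_zero]
  have hcritK {y : M} (hy : y ∈ K) (hyc : y ∈ critSet d (fun x ↦ F x + ε * h x)) :
      y ∈ ({w, z} : Set M) := by
    obtain ⟨h1, h2⟩ := hεK y hy hyc
    have hyγ : y ∈ Set.range c := hUγ ▸ ⟨interior_subset (hKU hy), h1⟩
    refine hmemB hyγ ((Φ (s y)).sin_eq_zero_of_mem_critSet hcont hh hhc ?_)
    rwa [hs y hyγ]
  have hcritU : U ∩ critSet d (fun x ↦ F x + ε * h x) = {w, z} := by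
    apply Set.Subset.antisymm
    · rintro y ⟨hyU, hyc⟩
      by_cases hy : y ∈ K
      · exact hcritK hy hyc
      -- Off `K` the function is unchanged, so a critical point in `U` would lie on γ, which is
      -- inside `K`.
      · have hyγ : y ∈ Set.range c := hUγ ▸ ⟨hyU, (mem_critSet_congr (houtside hy)).2 hyc⟩
        exact absurd (interior_subset (hγV hyγ)) hy
    · rintro y (rfl | rfl)
      · exact ⟨subset_of_mem_nhdsSet hU hwγ, hndw.1⟩
      · exact ⟨subset_of_mem_nhdsSet hU hzγ, hndz.1⟩
  have hiso {p q : M} (hpq : p ≠ q) (hp : p ∈ Set.range c)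
      (hcr : U ∩ critSet d (fun x ↦ F x + ε * h x) ⊆ {p, q}) :
      ∀ᶠ x in 𝓝 p, x ∈ critSet d (fun x ↦ F x + ε * h x) → x = p := by
    filter_upwards [mem_nhdsSet_iff_forall.1 hU p hp, isOpen_ne.mem_nhds hpq] with x hxU hxq hx
    exact (hcr ⟨hxU, hx⟩).resolve_right hxq
  refine ⟨fun x ↦ F x + ε * h x, ⟨contMDiff_add_mul hF.1 hh ε, fun p hp ↦ ?_⟩, fun x hx ↦ ?_,
    w, hwγ, z, hzγ, hndw, hndz, hcritU⟩
  -- In `K` the critical points are isolated and nondegenerate; off `K` the normal form of `F` is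
  -- inherited.
  · by_cases hpK : p ∈ K
    · rcases hcritK hpK hp with rfl | rfl
      · exact isBottAt_of_nondegenerate hndw (hiso hwz hwγ hcritU.le)
      · exact isBottAt_of_nondegenerate hndz (hiso hwz.symm hzγ (Set.pair_comm w z ▸ hcritU.le))
    · exact IsBottAt.congr (hF.2 p ((mem_critSet_congr (houtside hpK)).2 hp)) (houtside hpK)
  · exact (houtside fun hxK ↦ hx (interior_subset (hKU hxK))).self_of_nhds.symm
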